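/- Let $M$ be a closed smooth $3$-manifold and let $\xi\subset TM$ be a contact structure, i.e. a plane field that is locally the kernel of a smooth one-form $\alpha$ with $\alpha\wedge d\alpha\neq 0$ everywhere. A smooth Riemannian metric $\langle\cdot,\cdot\rangle$ on $M$ is called compatible with $\xi$ if there are a global smooth one-form $\alpha$ with $\ker\alpha=\xi$ and $\alpha\wedge d\alpha\ne0$ everywhere, with Reeb vector field $N$ (so $\alpha(N)=1$ and $\iota_N d\alpha=0$), an almost complex structure $J$ on $\xi$ (so $J^2=-\mathrm{id}$ on $\xi$), extended to $TM$ by $JN=0$, and a real constant $k$ such that $$\langle N,X\rangle=\alpha(X),\qquad k\,\langle X,JY\rangle=d\alpha(X,Y)$$ for all vector fields $X,Y$ on $M$. Theorem. Suppose that $\xi$ cannot be decomposed as a direct sum $\xi=\eta_1\oplus\eta_2$ of two smooth line subbundles. Then no Riemannian metric compatible with $\xi$ has nonpositive sectional curvature. (In particular, no nonflat metric of nonpositive curvature is compatible with $\xi$.) -/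

import Mathlib

open Bundle Set VectorField FiberBundle
open scoped Manifold ContDiff Topology

local notation "E3" => EuclideanSpace ℝ (Fin 3)

noncomputable section

namespace ContactGeometry

section OneForms

variable {M : Type*} [TopologicalSpace M] [ChartedSpace E3 M]

/-- A vector field is smooth on the set `U`. -/
def SmoothVectorFieldOn [IsManifold (𝓡 3) ∞ M] (X : ∀ p : M, TangentSpace (𝓡 3) p)
    (U : Set M) : Prop :=
  ContMDiffOn (𝓡 3) ((𝓡 3).prod 𝓘(ℝ, E3)) ∞
    (fun p ↦ TotalSpace.mk' E3 (E := fun q : M ↦ TangentSpace (𝓡 3) q) p (X p)) U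

/-- A one-form is smooth on the set `U`. -/
def SmoothOneFormOn [IsManifold (𝓡 3) ∞ M] (α : ∀ p : M, TangentSpace (𝓡 3) p →L[ℝ] ℝ)
    (U : Set M) : Prop :=
  ContMDiffOn (𝓡 3) ((𝓡 3).prod 𝓘(ℝ, E3 →L[ℝ] ℝ)) ∞
    (fun p ↦ TotalSpace.mk' (E3 →L[ℝ] ℝ)
      (E := fun q : M ↦ TangentSpace (𝓡 3) q →L[ℝ] Trivial M ℝ q) p (α p)) U

/-- `X(α(Y)) - Y(α(X)) - α([X, Y])` at the point `p`. -/
def dOnFields (α : ∀ p : M, TangentSpace (𝓡 3) p →L[ℝ] ℝ)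
    (X Y : ∀ p : M, TangentSpace (𝓡 3) p) (p : M) : ℝ :=
  mvfderiv (𝓡 3) (fun q ↦ α q (Y q)) p (X p) - mvfderiv (𝓡 3) (fun q ↦ α q (X q)) p (Y p)
    - α p (mlieBracket (𝓡 3) X Y p)

/-- The exterior derivative `dα` of a one-form, as a bilinear form on each tangent space:
tangent vectors are extended to vector fields that are smooth near the point and
`dα(X, Y) = X(α(Y)) - Y(α(X)) - α([X, Y])` is used. By `dForm_apply` below, the value does not
depend on the extension. -/
def dForm [IsManifold (𝓡 3) ∞ M] (α : ∀ p : M, TangentSpace (𝓡 3) p →L[ℝ] ℝ) (p : M)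
    (u v : TangentSpace (𝓡 3) p) : ℝ :=
  dOnFields α (extend E3 u) (extend E3 v) p

/-- A vector field is differentiable at `p`. -/
abbrev DifferentiableFieldAt [IsManifold (𝓡 3) ∞ M] (X : ∀ p : M, TangentSpace (𝓡 3) p)
    (p : M) : Prop :=
  MDifferentiableAt (𝓡 3) ((𝓡 3).prod 𝓘(ℝ, E3))
    (fun p ↦ TotalSpace.mk' E3 (E := fun q : M ↦ TangentSpace (𝓡 3) q) p (X p)) p

theorem dForm_apply [IsManifold (𝓡 3) ∞ M] {α : ∀ p : M, TangentSpace (𝓡 3) p →L[ℝ] ℝ} {p : M}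
    (hα : MDifferentiableAt (𝓡 3) ((𝓡 3).prod 𝓘(ℝ, E3 →L[ℝ] ℝ))
      (fun p ↦ TotalSpace.mk' (E3 →L[ℝ] ℝ)
        (E := fun q : M ↦ TangentSpace (𝓡 3) q →L[ℝ] Trivial M ℝ q) p (α p)) p)
    {X Y : ∀ p : M, TangentSpace (𝓡 3) p} (hX : DifferentiableFieldAt X p)
    (hY : DifferentiableFieldAt Y p) :
    dForm α p (X p) (Y p) = dOnFields α X Y p := by
  have hd : ∀ {Z : ∀ p : M, TangentSpace (𝓡 3) p}, DifferentiableFieldAt Z p →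
      MDifferentiableAt (𝓡 3) 𝓘(ℝ, ℝ) (fun q ↦ α q (Z q)) p := by
    intro Z hZ
    have := MDifferentiableAt.clm_bundle_apply (F₁ := E3) (F₂ := ℝ)
      (E₁ := fun q : M ↦ TangentSpace (𝓡 3) q) (E₂ := Trivial M ℝ) (b := fun q : M ↦ q)
      (ϕ := fun q ↦ α q) (v := Z) hα hZ
    rw [mdifferentiableAt_section] at this
    simpa using this
  have hs : ∀ Z : ∀ p : M, TangentSpace (𝓡 3) p, DifferentiableFieldAt Z p →
      TensorialAt (𝓡 3) E3 (fun W ↦ dOnFields α W Z p) p := by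
    intro Z hZ
    constructor
    · intro f σ hf hσ
      have h1 : (fun q ↦ α q ((f • σ) q)) = f * fun q ↦ α q (σ q) := by
        ext q; simp
      simp only [dOnFields, h1]
      simp [ mvfderiv_mul hf (hd hσ), mlieBracket_smul_left hf hσ]
      ring
    · intro σ σ' hσ hσ'
      have h1 : (fun q ↦ α q ((σ + σ') q)) = (fun q ↦ α q (σ q)) + fun q ↦ α q (σ' q) := by
        ext q; simp
      simp only [dOnFields, h1]
      simp [ mvfderiv_add (hd hσ) (hd hσ'), mlieBracket_add_left hσ hσ']
      ring
  have hsw : ∀ Z W : ∀ p : M, TangentSpace (𝓡 3) p, dOnFields α Z W p = - dOnFields α W Z p := by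
    intro Z W
    simp only [dOnFields]
    rw [mlieBracket_swap_apply]
    simp
    ring
  refine TensorialAt.pointwise₂ (I := 𝓡 3) (F := E3) (F' := E3)
    (Φ := fun W Z ↦ dOnFields α W Z p) hs (fun Z hZ ↦ ?_)
    (mdifferentiableAt_extend ..) hX (mdifferentiableAt_extend ..) hY (by simp) (by simp)
  have := hs Z hZ
  constructor
  · intro f σ hf hσ
    have := this.smul hf hσ
    beta_reduce at this ⊢
    simp only [smul_eq_mul] at this ⊢
    rw [hsw, this, hsw Z σ]; ring
  · intro σ σ' hσ hσ'
    have := this.add hσ hσ'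
    beta_reduce at this ⊢
    rw [hsw, this, hsw Z σ, hsw Z σ']; ring

/-- `(α ∧ dα)_p ≠ 0`. -/
def IsContactFormAt [IsManifold (𝓡 3) ∞ M] (α : ∀ p : M, TangentSpace (𝓡 3) p →L[ℝ] ℝ)
    (p : M) : Prop :=
  ∃ u v w : TangentSpace (𝓡 3) p,
    α p u * dForm α p v w + α p v * dForm α p w u + α p w * dForm α p u v ≠ 0

/-- On the set `U`, `α` is a smooth contact form whose kernel is the plane field `ξ`. -/
def IsContactFormForOn [IsManifold (𝓡 3) ∞ M] (α : ∀ p : M, TangentSpace (𝓡 3) p →L[ℝ] ℝ)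
    (ξ : ∀ p : M, Submodule ℝ (TangentSpace (𝓡 3) p)) (U : Set M) : Prop :=
  SmoothOneFormOn α U ∧
    ∀ p ∈ U, IsContactFormAt α p ∧ ∀ v : TangentSpace (𝓡 3) p, v ∈ ξ p ↔ α p v = 0

/-- A contact structure: a field of tangent planes that is locally the kernel of a smooth
contact form. -/
def IsContactStructure [IsManifold (𝓡 3) ∞ M]
    (ξ : ∀ p : M, Submodule ℝ (TangentSpace (𝓡 3) p)) : Prop :=
  ∀ p : M, ∃ U : Set M, IsOpen U ∧ p ∈ U ∧ ∃ α, IsContactFormForOn α ξ U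

/-- `N` is the Reeb vector field of `α`. -/
def IsReebField [IsManifold (𝓡 3) ∞ M] (α : ∀ p : M, TangentSpace (𝓡 3) p →L[ℝ] ℝ)
    (N : ∀ p : M, TangentSpace (𝓡 3) p) : Prop :=
  ∀ p : M, α p (N p) = 1 ∧ ∀ v : TangentSpace (𝓡 3) p, dForm α p (N p) v = 0

/-- A smooth line subbundle of the tangent bundle: locally spanned by a nowhere vanishing smooth
vector field. -/
def IsLineSubbundle [IsManifold (𝓡 3) ∞ M]
    (η : ∀ p : M, Submodule ℝ (TangentSpace (𝓡 3) p)) : Prop :=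
  ∀ p : M, ∃ U : Set M, IsOpen U ∧ p ∈ U ∧ ∃ X : ∀ q : M, TangentSpace (𝓡 3) q,
    SmoothVectorFieldOn X U ∧ ∀ q ∈ U, X q ≠ 0 ∧ η q = Submodule.span ℝ {X q}

/-- `ξ = η₁ ⊕ η₂` for two line subbundles. -/
def SplitsIntoLines [IsManifold (𝓡 3) ∞ M]
    (ξ : ∀ p : M, Submodule ℝ (TangentSpace (𝓡 3) p)) : Prop :=
  ∃ η₁ η₂ : ∀ p : M, Submodule ℝ (TangentSpace (𝓡 3) p),
    IsLineSubbundle η₁ ∧ IsLineSubbundle η₂ ∧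
      ∀ p : M, Disjoint (η₁ p) (η₂ p) ∧ η₁ p ⊔ η₂ p = ξ p

end OneForms

section Curvature

/-- The Christoffel symbol (Levi-Civita connection term) at `x` of a metric `G` on an open subset of
`E3`: `Γ(u, v)` is the vector with
`G(Γ(u, v), w) = (D_u G(v, w) + D_v G(u, w) - D_w G(u, v)) / 2` for all `w`. -/
def christoffel (G : E3 → E3 →L[ℝ] E3 →L[ℝ] ℝ) (x u v : E3) : E3 :=
  (G x).inverse ((1 / 2 : ℝ) •
    (fderiv ℝ G x u v + fderiv ℝ G x v u - ((fderiv ℝ G x).flip u).flip v))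

/-- The curvature tensor `R(u, v)w = ∇_u ∇_v w - ∇_v ∇_u w` of the metric `G`, where `u, v, w` are
constant vector fields on `E3`. -/
def riemann (G : E3 → E3 →L[ℝ] E3 →L[ℝ] ℝ) (x u v w : E3) : E3 :=
  fderiv ℝ (fun y ↦ christoffel G y v w) x u - fderiv ℝ (fun y ↦ christoffel G y u w) x v
    + christoffel G x u (christoffel G x v w) - christoffel G x v (christoffel G x u w)

variable {M : Type*} [TopologicalSpace M] [ChartedSpace E3 M] [IsManifold (𝓡 3) ∞ M]

variable (M) in
/-- Smooth Riemannian metrics on `M`. -/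
abbrev Metric : Type _ :=
  ContMDiffRiemannianMetric (𝓡 3) ∞ E3 (fun p : M ↦ TangentSpace (𝓡 3) p)

/-- The metric read in the preferred chart at `p`. -/
def metricInChart (g : Metric M) (p : M) (x : E3) : E3 →L[ℝ] E3 →L[ℝ] ℝ :=
  let D : E3 →L[ℝ] E3 := mfderiv 𝓘(ℝ, E3) (𝓡 3) (extChartAt (𝓡 3) p).symm x
  let B : E3 →L[ℝ] E3 →L[ℝ] ℝ := g.inner ((extChartAt (𝓡 3) p).symm x)
  B.bilinearComp D D

/-- `⟨R(u, v)v, u⟩` at the point `p`, computed in the preferred chart at `p`. -/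
def curvatureForm (g : Metric M) (p : M) (u v : TangentSpace (𝓡 3) p) : ℝ :=
  let G := metricInChart g p
  let x : E3 := extChartAt (𝓡 3) p p
  let u' : E3 := mfderiv (𝓡 3) 𝓘(ℝ, E3) (extChartAt (𝓡 3) p) p u
  let v' : E3 := mfderiv (𝓡 3) 𝓘(ℝ, E3) (extChartAt (𝓡 3) p) p v
  G x (riemann G x u' v' v') u'

/-- The sectional curvature of the plane spanned by the linearly independent vectors `u`, `v`. -/
def sectionalCurvature (g : Metric M) (p : M) (u v : TangentSpace (𝓡 3) p) : ℝ :=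
  curvatureForm g p u v / (g.inner p u u * g.inner p v v - g.inner p u v ^ 2)

/-- The sectional curvature is nonpositive for every tangent plane. -/
def HasNonposCurvature (g : Metric M) : Prop :=
  ∀ (p : M) (u v : TangentSpace (𝓡 3) p), LinearIndependent ℝ ![u, v] →
    sectionalCurvature g p u v ≤ 0

/-- The metric `g` is compatible with `ξ`: there are a contact form `α` with kernel `ξ`, with Reeb
field `N`, an almost complex structure `J` on `ξ`, extended by `J N = 0`, and a constant `k` such
that `⟨N, X⟩ = α(X)` and `k ⟨X, J Y⟩ = dα(X, Y)`. -/
def IsCompatible (g : Metric M) (ξ : ∀ p : M, Submodule ℝ (TangentSpace (𝓡 3) p)) : Prop :=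
  ∃ (α : ∀ p : M, TangentSpace (𝓡 3) p →L[ℝ] ℝ) (N : ∀ p : M, TangentSpace (𝓡 3) p)
    (J : ∀ p : M, TangentSpace (𝓡 3) p →L[ℝ] TangentSpace (𝓡 3) p) (k : ℝ),
    IsContactFormForOn α ξ univ ∧ IsReebField α N ∧
    (∀ p : M, J p (N p) = 0 ∧ ∀ v ∈ ξ p, J p v ∈ ξ p ∧ J p (J p v) = -v) ∧
    (∀ (p : M) (u : TangentSpace (𝓡 3) p), g.inner p (N p) u = α p u) ∧
    ∀ (p : M) (u v : TangentSpace (𝓡 3) p), k * g.inner p u (J p v) = dForm α p u v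

end Curvature

end ContactGeometry

end

open ContactGeometry

/-! Write `Q = L_N g` for the Lie derivative of the metric along the Reeb field. It is symmetric and
kills `N`. The flow of `N` preserves `α` and `dα`, and on `ξ` the form `dα` is `k` times the area
form of `g` up to sign, so that flow preserves area in `ξ` and `Q` is trace-free on `ξ`
(`lieMetric_area`).

By Koszul, `⟨∇_u N, v⟩ = (dα(u, v) + Q(u, v)) / 2`, hence `∇N` is trace-free and kills `N`. Tracing
the Riccati equation `curvatureAt_reeb` gives `Ric(N, N) = -tr((∇N)²)` (`ricci_reeb`). Where `Q =
0`, `∇N` is a quarter turn of `ξ` scaled by `±k/2`, so `Ric(N, N) = k²/2 > 0` (`ricci_reeb_pos`),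
which is impossible when all sectional curvatures are nonpositive.

Under nonpositive curvature `Q` therefore vanishes nowhere (`lieMetric_ne_zero`). A nonzero
trace-free symmetric endomorphism of a plane has two distinct eigenvalues `±λ`, and its eigenlines
depend smoothly on the point (`isLineSubbundle_eigenline`). They split `ξ`
(`splitsIntoLines_of_nonpos`), against the hypothesis. The analysis takes place on open sets of a
vector space, and naturality of `Q` under chart transitions makes the eigenlines global. -/

noncomputable section

set_option maxSynthPendingDepth 3

namespace ContactGeometry

/-! ### Orthonormal frames and inverses of inner products in dimension three. -/

section LinearAlgebra

variable {V : Type*} [NormedAddCommGroup V] [NormedSpace ℝ V]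

theorem exists_ne_zero_common_kernel (hV : Module.finrank ℝ V = 3) (f h : V →L[ℝ] ℝ) :
    ∃ v : V, v ≠ 0 ∧ f v = 0 ∧ h v = 0 := by
  have : FiniteDimensional ℝ V := .of_finrank_pos (by omega)
  have hlt : Module.finrank ℝ (ℝ × ℝ) < Module.finrank ℝ V := by simp [hV]
  have hne := LinearMap.ker_ne_bot_of_finrank_lt
    (f := (f : V →ₗ[ℝ] ℝ).prod (h : V →ₗ[ℝ] ℝ)) hlt
  obtain ⟨v, hv, hv0⟩ := Submodule.exists_mem_ne_zero_of_ne_bot hne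
  have : f v = 0 ∧ h v = 0 := by simpa using hv
  exact ⟨v, hv0, this.1, this.2⟩

/-- `n`, `e`, `f` are orthonormal for the bilinear form `B`. -/
structure IsFrame (B : V →L[ℝ] V →L[ℝ] ℝ) (n e f : V) : Prop where
  symm : ∀ u v, B u v = B v u
  nn : B n n = 1
  ee : B e e = 1
  ff : B f f = 1
  ne : B n e = 0
  nf : B n f = 0
  ef : B e f = 0

/-- Replaces Gram–Schmidt: two linear conditions in dimension three always leave a direction, which
is then normalised. -/
theorem exists_unit_common_kernel (hV : Module.finrank ℝ V = 3)
    {B : V →L[ℝ] V →L[ℝ] ℝ} (hpos : ∀ v, v ≠ 0 → 0 < B v v)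
    (f h : V →L[ℝ] ℝ) : ∃ v : V, B v v = 1 ∧ f v = 0 ∧ h v = 0 := by
  obtain ⟨v, hv, hf, hh⟩ := exists_ne_zero_common_kernel hV f h
  have h0 := hpos v hv
  have hs := Real.sqrt_pos.2 h0
  refine ⟨(√(B v v))⁻¹ • v, ?_, by simp [hf], by simp [hh]⟩
  simp only [map_smul, _root_.smul_apply, smul_eq_mul]
  field_simp
  exact (Real.sq_sqrt h0.le).symm

theorem exists_isFrame (hV : Module.finrank ℝ V = 3)
    {B : V →L[ℝ] V →L[ℝ] ℝ} (hsymm : ∀ u v, B u v = B v u)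
    (hpos : ∀ v, v ≠ 0 → 0 < B v v) {n : V} (hn : B n n = 1) : ∃ e f, IsFrame B n e f := by
  obtain ⟨e, he, hne, -⟩ := exists_unit_common_kernel hV hpos (B n) 0
  obtain ⟨f, hf, hnf, hef⟩ := exists_unit_common_kernel hV hpos (B n) (B e)
  exact ⟨e, f, hsymm, hn, he, hf, hne, hnf, hef⟩

namespace IsFrame

variable {B : V →L[ℝ] V →L[ℝ] ℝ} {n e f : V}

theorem en (h : IsFrame B n e f) : B e n = 0 := by rw [h.symm, h.ne]

theorem fn (h : IsFrame B n e f) : B f n = 0 := by rw [h.symm, h.nf]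

theorem fe (h : IsFrame B n e f) : B f e = 0 := by rw [h.symm, h.ef]

theorem linearIndependent (h : IsFrame B n e f) : LinearIndependent ℝ ![n, e, f] := by
  rw [Fintype.linearIndependent_iff]
  intro c hc
  have h3 : c 0 • n + c 1 • e + c 2 • f = 0 := by simpa [Fin.sum_univ_three] using hc
  have h0 := congrArg (B n) h3
  have h1 := congrArg (B e) h3
  have h2 := congrArg (B f) h3
  simp [h.nn, h.ee, h.ff, h.ne, h.nf, h.ef, h.en, h.fn, h.fe] at h0 h1 h2
  intro i
  fin_cases i <;> assumption

/-- An orthonormal frame as a basis. -/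
def basis (hV : Module.finrank ℝ V = 3) (h : IsFrame B n e f) : Module.Basis (Fin 3) ℝ V :=
  basisOfLinearIndependentOfCardEqFinrank h.linearIndependent (by simp [hV])

theorem coe_basis (hV : Module.finrank ℝ V = 3) (h : IsFrame B n e f) :
    ⇑(h.basis hV) = ![n, e, f] := by
  simp [basis]

theorem repr_eq (hV : Module.finrank ℝ V = 3) (h : IsFrame B n e f) (v : V) :
    (h.basis hV).repr v 0 = B n v ∧ (h.basis hV).repr v 1 = B e v ∧
      (h.basis hV).repr v 2 = B f v := by
  have h3 := (h.basis hV).sum_repr v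
  simp only [Fin.sum_univ_three, h.coe_basis hV] at h3
  have h0 := congrArg (B n) h3
  have h1 := congrArg (B e) h3
  have h2 := congrArg (B f) h3
  simp [h.nn, h.ee, h.ff, h.ne, h.nf, h.ef, h.en, h.fn, h.fe] at h0 h1 h2
  exact ⟨h0, h1, h2⟩

theorem expand (hV : Module.finrank ℝ V = 3) (h : IsFrame B n e f) (v : V) :
    v = B n v • n + B e v • e + B f v • f := by
  have h3 := (h.basis hV).sum_repr v
  rw [Fin.sum_univ_three, (h.repr_eq hV v).1, (h.repr_eq hV v).2.1, (h.repr_eq hV v).2.2] at h3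
  simpa [h.coe_basis hV] using h3.symm

theorem trace_eq (hV : Module.finrank ℝ V = 3) (h : IsFrame B n e f) (T : V →L[ℝ] V) :
    LinearMap.trace ℝ V T = B n (T n) + B e (T e) + B f (T f) := by
  rw [LinearMap.trace_eq_matrix_trace ℝ (h.basis hV), Matrix.trace, Fin.sum_univ_three]
  simp only [Matrix.diag_apply, LinearMap.toMatrix_apply, h.coe_basis hV]
  simp [(h.repr_eq hV _).1, (h.repr_eq hV _).2.1, (h.repr_eq hV _).2.2]

end IsFrame

variable [FiniteDimensional ℝ V]

/-- `ContinuousLinearMap.inverse` is zero on maps that are not invertible, so this is what gives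
meaning to raising an index with `B.inverse`. -/
theorem isInvertible_of_pos {B : V →L[ℝ] V →L[ℝ] ℝ} (hpos : ∀ v, v ≠ 0 → 0 < B v v) :
    B.IsInvertible := by
  have hinj : Function.Injective B := by
    rw [injective_iff_map_eq_zero]
    intro v hv
    by_contra h0
    have := hpos v h0
    rw [hv] at this
    simp at this
  have hdim : Module.finrank ℝ V = Module.finrank ℝ (V →L[ℝ] ℝ) := by
    rw [← LinearMap.toContinuousLinearMap.finrank_eq]
    exact (Subspace.dual_finrank_eq (K := ℝ) (V := V)).symm
  refine ⟨(LinearEquiv.ofInjectiveOfFinrankEq (B : V →ₗ[ℝ] (V →L[ℝ] ℝ)) hinj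
    hdim).toContinuousLinearEquiv, ?_⟩
  ext u v
  rfl

theorem apply_inverse_of_pos {B : V →L[ℝ] V →L[ℝ] ℝ} (hpos : ∀ v, v ≠ 0 → 0 < B v v)
    (φ : V →L[ℝ] ℝ) : B (B.inverse φ) = φ := by
  obtain ⟨e, rfl⟩ := isInvertible_of_pos hpos
  simp

omit [FiniteDimensional ℝ V] in
theorem eq_of_forall_apply_eq {B : V →L[ℝ] V →L[ℝ] ℝ} (hpos : ∀ v, v ≠ 0 → 0 < B v v)
    {u v : V} (h : ∀ w, B u w = B v w) : u = v := by
  by_contra hne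
  have := hpos (u - v) (sub_ne_zero.2 hne)
  simp [h] at this

end LinearAlgebra

/-! ### The Lie derivative of a contact metric along its Reeb field, on an open subset of a vector
space. -/

section Local

variable {V : Type*} [NormedAddCommGroup V] [NormedSpace ℝ V]

/-- The one-form dual to the vector field `N`. -/
def dualForm (G : V → V →L[ℝ] V →L[ℝ] ℝ) (N : V → V) (y : V) : V →L[ℝ] ℝ := G y (N y)

/-- The exterior derivative of a one-form on `V`. -/
def extDer (α : V → V →L[ℝ] ℝ) (y : V) : V →L[ℝ] V →L[ℝ] ℝ :=
  fderiv ℝ α y - (fderiv ℝ α y).flip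

/-- The Lie derivative of the metric `G` along the vector field `N`. -/
def lieMetric (G : V → V →L[ℝ] V →L[ℝ] ℝ) (N : V → V) (y : V) : V →L[ℝ] V →L[ℝ] ℝ :=
  fderiv ℝ G y (N y) + (G y).comp (fderiv ℝ N y) + ((G y).flip.comp (fderiv ℝ N y)).flip

variable {G : V → V →L[ℝ] V →L[ℝ] ℝ} {N : V → V} {k : ℝ} {U : Set V} {y : V}

theorem extDer_apply (α : V → V →L[ℝ] ℝ) (y u v : V) :
    extDer α y u v = fderiv ℝ α y u v - fderiv ℝ α y v u := rfl

theorem lieMetric_apply (G : V → V →L[ℝ] V →L[ℝ] ℝ) (N : V → V) (y u v : V) :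
    lieMetric G N y u v =
      fderiv ℝ G y (N y) u v + G y (fderiv ℝ N y u) v + G y u (fderiv ℝ N y v) := rfl

/-- On the open set `U`, `G` is a metric, `N` is a unit field, the Reeb field of its dual form `α`,
and `dα` restricted to the kernel of `α` is a constant multiple of the area form. -/
structure IsContactMetricOn (G : V → V →L[ℝ] V →L[ℝ] ℝ) (N : V → V) (k : ℝ) (U : Set V) :
    Prop where
  isOpen : IsOpen U
  contDiffOn_metric : ContDiffOn ℝ ∞ G U
  contDiffOn_reeb : ContDiffOn ℝ ∞ N U
  symm : ∀ y ∈ U, ∀ u v, G y u v = G y v u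
  pos : ∀ y ∈ U, ∀ v, v ≠ 0 → 0 < G y v v
  unit : ∀ y ∈ U, G y (N y) (N y) = 1
  reeb : ∀ y ∈ U, ∀ v, extDer (dualForm G N) y (N y) v = 0
  -- The bracket is the Gram determinant of the `ξ`-components of `u` and `v`. Squaring removes `J`
  -- and the orientation of `ξ`; allowing all `u`, `v` lets the identity be differentiated with
  -- constant vectors, which need not stay in `ξ`.
  area : ∀ y ∈ U, ∀ u v, extDer (dualForm G N) y u v ^ 2 =
    k ^ 2 * ((G y u u - G y (N y) u ^ 2) * (G y v v - G y (N y) v ^ 2)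
      - (G y u v - G y (N y) u * G y (N y) v) ^ 2)
  ne_zero : k ≠ 0

namespace IsContactMetricOn

theorem hasFDerivAt_metric (h : IsContactMetricOn G N k U) (hy : y ∈ U) :
    HasFDerivAt G (fderiv ℝ G y) y :=
  ((h.contDiffOn_metric.contDiffAt (h.isOpen.mem_nhds hy)).differentiableAt (by simp)).hasFDerivAt

theorem hasFDerivAt_reeb (h : IsContactMetricOn G N k U) (hy : y ∈ U) :
    HasFDerivAt N (fderiv ℝ N y) y :=
  ((h.contDiffOn_reeb.contDiffAt (h.isOpen.mem_nhds hy)).differentiableAt (by simp)).hasFDerivAt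

theorem contDiffOn_dualForm (h : IsContactMetricOn G N k U) : ContDiffOn ℝ ∞ (dualForm G N) U :=
  h.contDiffOn_metric.clm_apply h.contDiffOn_reeb

theorem hasFDerivAt_dualForm (h : IsContactMetricOn G N k U) (hy : y ∈ U) :
    HasFDerivAt (dualForm G N) (fderiv ℝ (dualForm G N) y) y :=
  ((h.contDiffOn_dualForm.contDiffAt (h.isOpen.mem_nhds hy)).differentiableAt
    (by simp)).hasFDerivAt

theorem fderiv_dualForm (h : IsContactMetricOn G N k U) (hy : y ∈ U) (u v : V) :
    fderiv ℝ (dualForm G N) y u v = fderiv ℝ G y u (N y) v + G y (fderiv ℝ N y u) v := by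
  have := ((h.hasFDerivAt_metric hy).clm_apply (h.hasFDerivAt_reeb hy)).fderiv
  have h2 : fderiv ℝ (dualForm G N) y = _ := this
  rw [h2]
  simp [add_comm]

theorem fderiv_metric_symm (h : IsContactMetricOn G N k U) (hy : y ∈ U) (w u v : V) :
    fderiv ℝ G y w u v = fderiv ℝ G y w v u := by
  have h1 := ((h.hasFDerivAt_metric hy).clm_apply (hasFDerivAt_const u y)).clm_apply
    (hasFDerivAt_const v y)
  have h2 := ((h.hasFDerivAt_metric hy).clm_apply (hasFDerivAt_const v y)).clm_apply
    (hasFDerivAt_const u y)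
  have heq : (fun z ↦ G z u v) =ᶠ[𝓝 y] fun z ↦ G z v u := by
    filter_upwards [h.isOpen.mem_nhds hy] with z hz using h.symm z hz u v
  have := congrArg (fun L ↦ L w) (h1.unique (h2.congr_of_eventuallyEq heq))
  simpa using this

theorem fderiv_unit (h : IsContactMetricOn G N k U) (hy : y ∈ U) (v : V) :
    fderiv ℝ G y v (N y) (N y) + 2 * G y (fderiv ℝ N y v) (N y) = 0 := by
  have h1 := ((h.hasFDerivAt_metric hy).clm_apply (h.hasFDerivAt_reeb hy)).clm_apply
    (h.hasFDerivAt_reeb hy)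
  have heq : (fun z ↦ G z (N z) (N z)) =ᶠ[𝓝 y] fun _ ↦ 1 := by
    filter_upwards [h.isOpen.mem_nhds hy] with z hz using h.unit z hz
  have := congrArg (fun L ↦ L v)
    (h1.unique ((hasFDerivAt_const (1 : ℝ) y).congr_of_eventuallyEq heq))
  simp at this
  rw [h.symm y hy (N y)] at this
  linarith

theorem lieMetric_symm (h : IsContactMetricOn G N k U) (hy : y ∈ U) (u v : V) :
    lieMetric G N y u v = lieMetric G N y v u := by
  simp only [lieMetric_apply]
  rw [h.fderiv_metric_symm hy _ u v, h.symm y hy _ v, h.symm y hy u]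
  ring

/-- `Q(N, ·) = L_N α` because `α = ⟨N, ·⟩` and `L_N N = 0`. Concretely, it is the sum of `dα(N, ·) =
0` and the derivative of `⟨N, N⟩ = 1`. -/
theorem lieMetric_reeb (h : IsContactMetricOn G N k U) (hy : y ∈ U) (v : V) :
    lieMetric G N y (N y) v = 0 := by
  have h1 := h.reeb y hy v
  rw [extDer_apply, h.fderiv_dualForm hy, h.fderiv_dualForm hy] at h1
  have h2 := h.fderiv_unit hy v
  rw [lieMetric_apply, h.symm y hy (N y)]
  linarith

/-- `L_N α = 0`. -/
theorem lie_dualForm (h : IsContactMetricOn G N k U) (hy : y ∈ U) (v : V) :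
    fderiv ℝ (dualForm G N) y (N y) v = - G y (N y) (fderiv ℝ N y v) := by
  have h1 := h.lieMetric_reeb hy v
  rw [lieMetric_apply] at h1
  rw [h.fderiv_dualForm hy]
  linarith

theorem hasFDerivAt_fderiv_dualForm (h : IsContactMetricOn G N k U) (hy : y ∈ U) :
    HasFDerivAt (fderiv ℝ (dualForm G N)) (fderiv ℝ (fderiv ℝ (dualForm G N)) y) y := by
  have hs : ContDiffAt ℝ ∞ (dualForm G N) y :=
    h.contDiffOn_dualForm.contDiffAt (h.isOpen.mem_nhds hy)
  exact ((hs.fderiv_right (m := ∞) (by simp)).differentiableAt (by simp)).hasFDerivAt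

/-- `L_N dα = 0`. -/
theorem lie_extDer (h : IsContactMetricOn G N k U) (hy : y ∈ U) (u v : V) :
    HasLineDerivAt ℝ (fun z ↦ extDer (dualForm G N) z u v)
      (- extDer (dualForm G N) y (fderiv ℝ N y u) v
        - extDer (dualForm G N) y u (fderiv ℝ N y v)) y (N y) := by
  have hs : ContDiffAt ℝ ∞ (dualForm G N) y :=
    h.contDiffOn_dualForm.contDiffAt (h.isOpen.mem_nhds hy)
  have hsym : IsSymmSndFDerivAt ℝ (dualForm G N) y :=
    hs.isSymmSndFDerivAt (by simpa using WithTop.coe_le_coe.2 (le_top (a := (2 : ℕ∞))))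
  have hD := h.hasFDerivAt_fderiv_dualForm hy
  have heq0 : ∀ v, (fun z ↦ extDer (dualForm G N) z (N z) v) =ᶠ[𝓝 y] fun _ ↦ 0 := by
    intro v
    filter_upwards [h.isOpen.mem_nhds hy] with z hz using h.reeb z hz v
  have hN := h.hasFDerivAt_reeb hy
  simp only [extDer_apply] at heq0 ⊢
  set D := fderiv ℝ (dualForm G N) with hDdef
  have hc : ∀ w : V, HasFDerivAt (fun _ : V ↦ w) (0 : V →L[ℝ] V) y :=
    fun w ↦ hasFDerivAt_const w y
  have hE : ∀ u v : V, HasFDerivAt (fun z ↦ D z u v) _ y := fun u v ↦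
    (hD.clm_apply (hc u)).clm_apply (hc v)
  -- The derivative of `ι_N dα = 0` in the direction `u`. Its antisymmetrisation, with the symmetry
  -- of second derivatives of `α` in `h3`–`h5` (that is, `d(dα) = 0`), is Cartan's formula.
  have key : ∀ u v, fderiv ℝ D y u (N y) v - fderiv ℝ D y u v (N y)
      + (D y (fderiv ℝ N y u) v - D y v (fderiv ℝ N y u)) = 0 := by
    intro u v
    have h1 := ((hD.clm_apply hN).clm_apply (hc v)).sub ((hD.clm_apply (hc v)).clm_apply hN)
    have := congrArg (fun L ↦ L u)
      (h1.unique ((hasFDerivAt_const (0 : ℝ) y).congr_of_eventuallyEq (heq0 v)))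
    simp at this
    linarith
  have h1 := key u v
  have h2 := key v u
  have h3 : (fderiv ℝ D y (N y)) u v = fderiv ℝ D y u (N y) v := by
    rw [hDdef, hsym.eq (N y) u]
  have h4 : (fderiv ℝ D y (N y)) v u = fderiv ℝ D y v (N y) u := by
    rw [hDdef, hsym.eq (N y) v]
  have h5 : (fderiv ℝ D y u) v (N y) = fderiv ℝ D y v u (N y) := by
    rw [hDdef, hsym.eq u v]
  have h6 := ((hE u v).sub (hE v u)).hasLineDerivAt (N y)
  convert h6 using 1
  · rfl
  simp
  linarith

/-- `L_N g` is trace-free on the kernel of `α`. -/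
theorem lieMetric_area (h : IsContactMetricOn G N k U) (hy : y ∈ U) {u v : V}
    (hu : G y (N y) u = 0) (hv : G y (N y) v = 0) :
    lieMetric G N y u u * G y v v + G y u u * lieMetric G N y v v
      - 2 * G y u v * lieMetric G N y u v = 0 := by
  set Ω := extDer (dualForm G N) with hΩ
  have hGuv : ∀ u v, HasDerivAt (fun t : ℝ ↦ G (y + t • N y) u v) (fderiv ℝ G y (N y) u v) 0 := by
    intro u v
    have h0 := ((h.hasFDerivAt_metric hy).clm_apply (hasFDerivAt_const u y)).clm_apply
      (hasFDerivAt_const v y)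
    have := h0.hasLineDerivAt (N y)
    simpa [HasLineDerivAt] using this
  have hαu : ∀ u, HasDerivAt (fun t : ℝ ↦ dualForm G N (y + t • N y) u)
      (- G y (N y) (fderiv ℝ N y u)) 0 := by
    intro u
    have h0 := (h.hasFDerivAt_dualForm hy).clm_apply (hasFDerivAt_const u y)
    have := h0.hasLineDerivAt (N y)
    simpa [HasLineDerivAt, h.lie_dualForm hy] using this
  have hΩu : HasDerivAt (fun t : ℝ ↦ Ω (y + t • N y) u v)
      (- Ω y (fderiv ℝ N y u) v - Ω y u (fderiv ℝ N y v)) 0 := by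
    have := h.lie_extDer hy u v
    simpa [HasLineDerivAt] using this
  -- Both sides of the area identity are differentiated along `t ↦ y + t • N y` at `t = 0`.
  have hd := (hΩu.pow 2).sub ((((((hGuv u u).sub ((hαu u).pow 2)).mul
    ((hGuv v v).sub ((hαu v).pow 2))).sub
    (((hGuv u v).sub ((hαu u).mul (hαu v))).pow 2))).const_mul (k ^ 2))
  have hc : ContinuousAt (fun t : ℝ ↦ y + t • N y) 0 := by fun_prop
  have hev : ∀ᶠ t in 𝓝 (0 : ℝ), y + t • N y ∈ U :=
    hc.eventually_mem (by simpa using h.isOpen.mem_nhds hy)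
  have h0 := hd.unique ((hasDerivAt_const (0 : ℝ) (0 : ℝ)).congr_of_eventuallyEq (by
    filter_upwards [hev] with t ht
    have := h.area _ ht u v
    simp only [Pi.sub_apply, Pi.mul_apply, Pi.pow_apply, dualForm]
    rw [← hΩ] at this
    linarith))
  have hA : ∀ u v, Ω y u v ^ 2 = k ^ 2 * ((G y u u - G y (N y) u ^ 2) *
      (G y v v - G y (N y) v ^ 2) - (G y u v - G y (N y) u * G y (N y) v) ^ 2) := h.area y hy
  set u' := fderiv ℝ N y u with hu'
  set v' := fderiv ℝ N y v with hv'
  -- Polarisation: `a1 - a2` and `a3 - a4` express the products `Ω(u, v) Ω(u', v)` and `Ω(u, v) Ω(u,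
  -- v')` through the metric, which removes `Ω` from `h0`.
  have a1 := hA (u + u') v
  have a2 := hA (u - u') v
  have a3 := hA u (v + v')
  have a4 := hA u (v - v')
  have hα0 : ∀ w, dualForm G N y w = G y (N y) w := fun _ ↦ rfl
  simp only [map_add, map_sub, _root_.add_apply, _root_.sub_apply,
    hu, hv, h.symm y hy u' u, h.symm y hy v' v, h.symm y hy u' v] at a1 a2 a3 a4
  simp only [Pi.sub_apply, Pi.mul_apply, Pi.pow_apply, zero_smul, add_zero, hα0, hu, hv] at h0
  rw [lieMetric_apply, lieMetric_apply, lieMetric_apply, ← hu', ← hv', h.symm y hy u' u,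
    h.symm y hy v' v, h.symm y hy u' v]
  have hk := pow_ne_zero 2 h.ne_zero
  refine mul_left_cancel₀ hk ?_
  norm_num at h0
  linear_combination (-1) * h0 + (-1/2) * (a1 - a2) + (-1/2) * (a3 - a4)

end IsContactMetricOn

end Local

/-! ### Smoothness and derivatives of families of linear maps. -/

section Calculus

theorem _root_.ContDiffAt.clm_flip {E₁ E₂ E₃ E₄ : Type*} [NormedAddCommGroup E₁]
    [NormedSpace ℝ E₁] [NormedAddCommGroup E₂] [NormedSpace ℝ E₂] [NormedAddCommGroup E₃]
    [NormedSpace ℝ E₃] [NormedAddCommGroup E₄] [NormedSpace ℝ E₄] {f : E₁ → E₂ →L[ℝ] E₃ →L[ℝ] E₄}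
    {x : E₁} {n : WithTop ℕ∞} (hf : ContDiffAt ℝ n f x) :
    ContDiffAt ℝ n (fun y ↦ (f y).flip) x :=
  (ContinuousLinearMap.flipₗᵢ ℝ E₂ E₃ E₄).contDiff.contDiffAt.comp x hf

theorem _root_.ContDiffAt.clm_inverse {E₁ E₂ E₃ : Type*} [NormedAddCommGroup E₁]
    [NormedSpace ℝ E₁] [NormedAddCommGroup E₂] [NormedSpace ℝ E₂] [CompleteSpace E₂]
    [NormedAddCommGroup E₃] [NormedSpace ℝ E₃] {f : E₁ → E₂ →L[ℝ] E₃} {x : E₁} {n : WithTop ℕ∞}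
    (hf : ContDiffAt ℝ n f x) (hx : (f x).IsInvertible) :
    ContDiffAt ℝ n (fun y ↦ (f y).inverse) x := by
  obtain ⟨e, he⟩ := hx
  have := contDiffAt_map_inverse (𝕜 := ℝ) (n := n) e
  rw [he] at this
  exact this.comp x hf

theorem _root_.ContDiffAt.clm_const_apply {E₁ E₂ E₃ : Type*} [NormedAddCommGroup E₁]
    [NormedSpace ℝ E₁] [NormedAddCommGroup E₂] [NormedSpace ℝ E₂] [NormedAddCommGroup E₃]
    [NormedSpace ℝ E₃] {f : E₁ → E₂ →L[ℝ] E₃} {x : E₁} {n : WithTop ℕ∞}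
    (hf : ContDiffAt ℝ n f x) (v : E₂) : ContDiffAt ℝ n (fun y ↦ f y v) x :=
  hf.clm_apply contDiffAt_const

theorem fderiv_clm_const_apply {E₁ E₂ E₃ : Type*} [NormedAddCommGroup E₁]
    [NormedSpace ℝ E₁] [NormedAddCommGroup E₂] [NormedSpace ℝ E₂] [NormedAddCommGroup E₃]
    [NormedSpace ℝ E₃] {f : E₁ → E₂ →L[ℝ] E₃} {x : E₁} (hf : DifferentiableAt ℝ f x) (v : E₂)
    (w : E₁) : fderiv ℝ (fun y ↦ f y v) x w = fderiv ℝ f x w v := by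
  rw [(hf.hasFDerivAt.clm_apply (hasFDerivAt_const v x)).fderiv]
  simp

theorem fderiv_clm_apply_apply {E₁ E₂ E₃ : Type*} [NormedAddCommGroup E₁]
    [NormedSpace ℝ E₁] [NormedAddCommGroup E₂] [NormedSpace ℝ E₂] [NormedAddCommGroup E₃]
    [NormedSpace ℝ E₃] {f : E₁ → E₂ →L[ℝ] E₃} {g : E₁ → E₂} {x : E₁}
    (hf : DifferentiableAt ℝ f x) (hg : DifferentiableAt ℝ g x) (w : E₁) :
    fderiv ℝ (fun y ↦ f y (g y)) x w = fderiv ℝ f x w (g x) + f x (fderiv ℝ g x w) := by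
  rw [(hf.hasFDerivAt.clm_apply hg.hasFDerivAt).fderiv]
  simp [add_comm]

end Calculus

/-! ### The covariant derivative of the Reeb field and the Ricci curvature in its direction. -/

section Connection

variable {V : Type*} [NormedAddCommGroup V] [NormedSpace ℝ V]

/-- `v ↦ Γ(u, v)` for the Christoffel symbol `Γ` of the metric `G` at `y`. -/
def christoffelLeft (G : V → V →L[ℝ] V →L[ℝ] ℝ) (u y : V) : V →L[ℝ] V :=
  (G y).inverse.comp ((1 / 2 : ℝ) •
    (fderiv ℝ G y u + (fderiv ℝ G y).flip u - ((fderiv ℝ G y).flip u).flip))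

/-- The curvature term `R(u, v)w` for constant vector fields `u`, `v`, `w`. -/
def curvatureAt (G : V → V →L[ℝ] V →L[ℝ] ℝ) (x u v w : V) : V :=
  fderiv ℝ (fun y ↦ christoffelLeft G v y w) x u - fderiv ℝ (fun y ↦ christoffelLeft G u y w) x v
    + christoffelLeft G u x (christoffelLeft G v x w)
    - christoffelLeft G v x (christoffelLeft G u x w)

/-- The covariant derivative `∇N` of the vector field `N`. -/
def covDeriv (G : V → V →L[ℝ] V →L[ℝ] ℝ) (N : V → V) (y : V) : V →L[ℝ] V :=
  (G y).inverse.comp ((1 / 2 : ℝ) • (extDer (dualForm G N) y + lieMetric G N y))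

variable {G : V → V →L[ℝ] V →L[ℝ] ℝ} {N : V → V} {k : ℝ} {U : Set V} {y : V}

namespace IsContactMetricOn

theorem contDiffAt_metric (h : IsContactMetricOn G N k U) (hy : y ∈ U) : ContDiffAt ℝ ∞ G y :=
  h.contDiffOn_metric.contDiffAt (h.isOpen.mem_nhds hy)

theorem contDiffAt_reeb (h : IsContactMetricOn G N k U) (hy : y ∈ U) : ContDiffAt ℝ ∞ N y :=
  h.contDiffOn_reeb.contDiffAt (h.isOpen.mem_nhds hy)

theorem contDiffAt_fderiv_metric (h : IsContactMetricOn G N k U) (hy : y ∈ U) :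
    ContDiffAt ℝ ∞ (fderiv ℝ G) y :=
  (h.contDiffAt_metric hy).fderiv_right (m := ∞) (by simp)

theorem contDiffAt_fderiv_reeb (h : IsContactMetricOn G N k U) (hy : y ∈ U) :
    ContDiffAt ℝ ∞ (fderiv ℝ N) y :=
  (h.contDiffAt_reeb hy).fderiv_right (m := ∞) (by simp)

theorem contDiffAt_lieMetric (h : IsContactMetricOn G N k U) (hy : y ∈ U) :
    ContDiffAt ℝ ∞ (lieMetric G N) y :=
  (((h.contDiffAt_fderiv_metric hy).clm_apply (h.contDiffAt_reeb hy)).add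
    ((h.contDiffAt_metric hy).clm_comp (h.contDiffAt_fderiv_reeb hy))).add
    ((h.contDiffAt_metric hy).clm_flip.clm_comp (h.contDiffAt_fderiv_reeb hy)).clm_flip

theorem contDiffAt_extDer (h : IsContactMetricOn G N k U) (hy : y ∈ U) :
    ContDiffAt ℝ ∞ (extDer (dualForm G N)) y := by
  have h1 : ContDiffAt ℝ ∞ (fderiv ℝ (dualForm G N)) y :=
    (h.contDiffOn_dualForm.contDiffAt (h.isOpen.mem_nhds hy)).fderiv_right (m := ∞) (by simp)
  exact h1.sub h1.clm_flip

variable [FiniteDimensional ℝ V]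

theorem contDiffAt_inverse_metric (h : IsContactMetricOn G N k U) (hy : y ∈ U) :
    ContDiffAt ℝ ∞ (fun z ↦ (G z).inverse) y := by
  have : CompleteSpace V := FiniteDimensional.complete ℝ V
  exact (h.contDiffAt_metric hy).clm_inverse (isInvertible_of_pos (h.pos y hy))

theorem contDiffAt_covDeriv (h : IsContactMetricOn G N k U) (hy : y ∈ U) :
    ContDiffAt ℝ ∞ (covDeriv G N) y :=
  (h.contDiffAt_inverse_metric hy).clm_comp
    (ContDiffAt.const_smul _ ((h.contDiffAt_extDer hy).add (h.contDiffAt_lieMetric hy)))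

theorem contDiffAt_christoffelLeft (h : IsContactMetricOn G N k U) (hy : y ∈ U) (u : V) :
    ContDiffAt ℝ ∞ (christoffelLeft G u) y := by
  have h1 := h.contDiffAt_fderiv_metric hy
  have h2 := h1.clm_flip.clm_const_apply u
  exact (h.contDiffAt_inverse_metric hy).clm_comp
    (ContDiffAt.const_smul _ (((h1.clm_const_apply u).add h2).sub h2.clm_flip))

theorem metric_christoffelLeft (h : IsContactMetricOn G N k U) (hy : y ∈ U) (u v w : V) :
    G y (christoffelLeft G u y v) w =
      (fderiv ℝ G y u v w + fderiv ℝ G y v u w - fderiv ℝ G y w u v) / 2 := by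
  rw [christoffelLeft, ContinuousLinearMap.comp_apply, apply_inverse_of_pos (h.pos y hy)]
  simp
  ring

theorem christoffelLeft_comm (h : IsContactMetricOn G N k U) (hy : y ∈ U) (u v : V) :
    christoffelLeft G u y v = christoffelLeft G v y u := by
  refine eq_of_forall_apply_eq (h.pos y hy) fun w ↦ ?_
  rw [h.metric_christoffelLeft hy, h.metric_christoffelLeft hy, h.fderiv_metric_symm hy w]
  ring

theorem metric_covDeriv (h : IsContactMetricOn G N k U) (hy : y ∈ U) (u v : V) :
    G y (covDeriv G N y u) v = (extDer (dualForm G N) y u v + lieMetric G N y u v) / 2 := by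
  rw [covDeriv, ContinuousLinearMap.comp_apply, apply_inverse_of_pos (h.pos y hy)]
  simp
  ring

/-- Justifies the definition of `covDeriv`: in Koszul's formula the skew part of `⟨∇_u N, v⟩` is `dα
/ 2` and the symmetric part is `L_N g / 2`. -/
theorem covDeriv_apply (h : IsContactMetricOn G N k U) (hy : y ∈ U) (u : V) :
    covDeriv G N y u = fderiv ℝ N y u + christoffelLeft G u y (N y) := by
  refine eq_of_forall_apply_eq (h.pos y hy) fun w ↦ ?_
  rw [map_add, _root_.add_apply, h.metric_christoffelLeft hy, h.metric_covDeriv hy, extDer_apply,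
    h.fderiv_dualForm hy, h.fderiv_dualForm hy, lieMetric_apply, h.symm y hy u,
    h.fderiv_metric_symm hy w u]
  ring

/-- The orbits of the Reeb field are geodesics. -/
theorem covDeriv_reeb (h : IsContactMetricOn G N k U) (hy : y ∈ U) :
    covDeriv G N y (N y) = 0 := by
  refine eq_of_forall_apply_eq (h.pos y hy) fun w ↦ ?_
  rw [h.metric_covDeriv hy, h.reeb y hy, h.lieMetric_reeb hy]
  simp

/-- The skew part contributes nothing to the trace, the symmetric part is trace-free on `ξ`, and `N`
is killed. -/
theorem trace_covDeriv (hV : Module.finrank ℝ V = 3) (h : IsContactMetricOn G N k U)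
    (hy : y ∈ U) : LinearMap.trace ℝ V (covDeriv G N y) = 0 := by
  obtain ⟨e, f, hf⟩ := exists_isFrame hV (h.symm y hy) (h.pos y hy) (h.unit y hy)
  rw [hf.trace_eq hV, h.covDeriv_reeb hy, h.symm y hy e, h.symm y hy f, h.metric_covDeriv hy,
    h.metric_covDeriv hy]
  have := h.lieMetric_area hy hf.ne hf.nf
  rw [hf.ee, hf.ff, hf.ef] at this
  simp only [extDer_apply, map_zero]
  linarith

/-- The Riccati equation for `∇N`. -/
theorem curvatureAt_reeb (h : IsContactMetricOn G N k U) (hy : y ∈ U) (u : V) :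
    curvatureAt G y u (N y) (N y) =
      - fderiv ℝ (covDeriv G N) y (N y) u - covDeriv G N y (covDeriv G N y u)
        + (fderiv ℝ N y (covDeriv G N y u) - covDeriv G N y (fderiv ℝ N y u)) := by
  have hA : DifferentiableAt ℝ (covDeriv G N) y :=
    (h.contDiffAt_covDeriv hy).differentiableAt (by simp)
  have hN : DifferentiableAt ℝ N y := (h.contDiffAt_reeb hy).differentiableAt (by simp)
  have hDN : DifferentiableAt ℝ (fderiv ℝ N) y :=
    (h.contDiffAt_fderiv_reeb hy).differentiableAt (by simp)
  have hΓ : ∀ u, DifferentiableAt ℝ (christoffelLeft G u) y := fun u ↦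
    (h.contDiffAt_christoffelLeft hy u).differentiableAt (by simp)
  have hsym : IsSymmSndFDerivAt ℝ N y :=
    (h.contDiffAt_reeb hy).isSymmSndFDerivAt
      (by simpa using WithTop.coe_le_coe.2 (le_top (a := (2 : ℕ∞))))
  have hAu : ∀ u w, fderiv ℝ (covDeriv G N) y w u = fderiv ℝ (fderiv ℝ N) y w u
      + (fderiv ℝ (christoffelLeft G u) y w (N y) + christoffelLeft G u y (fderiv ℝ N y w)) := by
    intro u w
    rw [← fderiv_clm_const_apply hA, ← fderiv_clm_const_apply hDN,
      ← fderiv_clm_apply_apply (hΓ u) hN, ← _root_.add_apply, ← fderiv_add]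
    · congr 1
      refine Filter.EventuallyEq.fderiv_eq ?_
      filter_upwards [h.isOpen.mem_nhds hy] with z hz using h.covDeriv_apply hz u
    · exact hDN.clm_apply (differentiableAt_const u)
    · exact (hΓ u).clm_apply hN
  -- The derivative of `∇_N N = 0`; with `h2` it eliminates the `u`-derivative of `Γ(N, N)` from the
  -- curvature.
  have hAN : fderiv ℝ (covDeriv G N) y u (N y) + covDeriv G N y (fderiv ℝ N y u) = 0 := by
    rw [← fderiv_clm_apply_apply hA hN]
    have : (fun z ↦ covDeriv G N z (N z)) =ᶠ[𝓝 y] fun _ ↦ 0 := by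
      filter_upwards [h.isOpen.mem_nhds hy] with z hz using h.covDeriv_reeb hz
    rw [this.fderiv_eq]
    simp
  have hNN := h.covDeriv_reeb hy
  rw [h.covDeriv_apply hy, ← eq_neg_iff_add_eq_zero] at hNN
  have h1 := hAu u (N y)
  have h2 := hAu (N y) u
  have h3 : fderiv ℝ (fderiv ℝ N) y u (N y) = fderiv ℝ (fderiv ℝ N) y (N y) u := hsym.eq _ _
  have h4 := h.covDeriv_apply hy (covDeriv G N y u)
  rw [h.christoffelLeft_comm hy _ (N y)] at h4
  have h5 : christoffelLeft G (N y) y (covDeriv G N y u) =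
      christoffelLeft G (N y) y (fderiv ℝ N y u)
        + christoffelLeft G (N y) y (christoffelLeft G u y (N y)) := by
    rw [h.covDeriv_apply hy u, map_add]
  have h6 : christoffelLeft G u y (fderiv ℝ N y (N y))
      = - christoffelLeft G u y (christoffelLeft G (N y) y (N y)) := by
    rw [hNN, map_neg]
  rw [curvatureAt, fderiv_clm_const_apply (hΓ _), fderiv_clm_const_apply (hΓ _)]
  rw [h6] at h1
  rw [h3] at h2
  rw [h5] at h4
  rw [h2] at hAN
  rw [h1, h4]
  rw [← sub_eq_zero, ← hAN]
  abel

/-- The trace of the Riccati equation. The trace of `∇N` vanishes near `y`, hence so does its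
derivative; the commutator of `DN` and `∇N` has trace zero. Since `R(N, N)N = 0`, the frame vector
`N` adds nothing on the curvature side. -/
theorem ricci_reeb (hV : Module.finrank ℝ V = 3) (h : IsContactMetricOn G N k U) (hy : y ∈ U)
    {e f : V} (hf : IsFrame (G y) (N y) e f) :
    G y (curvatureAt G y e (N y) (N y)) e + G y (curvatureAt G y f (N y) (N y)) f =
      - LinearMap.trace ℝ V ((covDeriv G N y).comp (covDeriv G N y)) := by
  have hA : DifferentiableAt ℝ (covDeriv G N) y :=
    (h.contDiffAt_covDeriv hy).differentiableAt (by simp)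
  let tr : (V →L[ℝ] V) →L[ℝ] ℝ :=
    ((LinearMap.trace ℝ V).comp (ContinuousLinearMap.coeLM ℝ)).toContinuousLinearMap
  have htr : ∀ T : V →L[ℝ] V, tr T = LinearMap.trace ℝ V T := fun _ ↦ rfl
  have hd : tr (fderiv ℝ (covDeriv G N) y (N y)) = 0 := by
    have h1 := (tr.hasFDerivAt.comp y hA.hasFDerivAt).fderiv
    have h2 : tr ∘ covDeriv G N =ᶠ[𝓝 y] fun _ ↦ 0 := by
      filter_upwards [h.isOpen.mem_nhds hy] with z hz using h.trace_covDeriv hV hz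
    rw [h2.fderiv_eq] at h1
    have := congrArg (fun L ↦ L (N y)) h1
    simpa using this.symm
  have hc : tr ((fderiv ℝ N y).comp (covDeriv G N y)) =
      tr ((covDeriv G N y).comp (fderiv ℝ N y)) := by
    rw [htr, htr]
    exact LinearMap.trace_mul_comm ℝ (fderiv ℝ N y : V →ₗ[ℝ] V) (covDeriv G N y : V →ₗ[ℝ] V)
  set R : V →L[ℝ] V := - fderiv ℝ (covDeriv G N) y (N y) - (covDeriv G N y).comp (covDeriv G N y)
    + ((fderiv ℝ N y).comp (covDeriv G N y) - (covDeriv G N y).comp (fderiv ℝ N y)) with hR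
  have hRu : ∀ u, curvatureAt G y u (N y) (N y) = R u := fun u ↦ h.curvatureAt_reeb hy u
  have hRN : R (N y) = 0 := by
    rw [← hRu, curvatureAt]
    simp
  have h1 : tr R = - tr ((covDeriv G N y).comp (covDeriv G N y)) := by
    rw [hR, map_add, map_sub, map_sub, map_neg, hd, hc]
    simp
  rw [← htr, ← h1, htr, hf.trace_eq hV, hRN, hRu, hRu, h.symm y hy e, h.symm y hy f]
  simp

/-- If `L_N g` vanishes at a point, then the Ricci curvature of `N` is positive there. -/
theorem ricci_reeb_pos (hV : Module.finrank ℝ V = 3) (h : IsContactMetricOn G N k U) (hy : y ∈ U)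
    {e f : V} (hf : IsFrame (G y) (N y) e f) (hQ : lieMetric G N y = 0) :
    0 < G y (curvatureAt G y e (N y) (N y)) e + G y (curvatureAt G y f (N y) (N y)) f := by
  set Ω := extDer (dualForm G N) y with hΩ
  have hA : ∀ u v, G y (covDeriv G N y u) v = Ω u v / 2 := by
    intro u v
    rw [h.metric_covDeriv hy, hQ]
    simp [hΩ]
  have hsk : ∀ u v, Ω u v = - Ω v u := fun u v ↦ by simp [hΩ, extDer_apply]
  have hs : ∀ u, Ω u u = 0 := fun u ↦ by simp [hΩ, extDer_apply]
  have hn : ∀ u, Ω u (N y) = 0 := fun u ↦ by rw [hsk, h.reeb y hy, neg_zero]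
  have hef := h.area y hy e f
  rw [hf.ee, hf.ff, hf.ef, hf.ne, hf.nf, ← hΩ] at hef
  -- With `Q = 0` only the skew part is left, so `∇N` is a quarter turn of the plane scaled by `Ω e
  -- f / 2`. Its square is `-k² / 4` there, since `hef` reads `Ω e f ^ 2 = k ^ 2`.
  have hAe : covDeriv G N y e = (Ω e f / 2) • f := by
    rw [hf.expand hV (covDeriv G N y e), h.symm y hy _ (covDeriv G N y e),
      h.symm y hy _ (covDeriv G N y e), h.symm y hy _ (covDeriv G N y e), hA, hA, hA, hn, hs]
    simp
  have hAf : covDeriv G N y f = - (Ω e f / 2) • e := by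
    rw [hf.expand hV (covDeriv G N y f), h.symm y hy _ (covDeriv G N y f),
      h.symm y hy _ (covDeriv G N y f), h.symm y hy _ (covDeriv G N y f), hA, hA, hA, hn, hs,
      hsk f e]
    simp [neg_div]
  rw [h.ricci_reeb hV hy hf, hf.trace_eq hV]
  simp only [ContinuousLinearMap.comp_apply, h.covDeriv_reeb hy, hAe, hAf, map_smul, map_zero,
    smul_eq_mul, hf.ee, hf.ff]
  have := pow_pos (abs_pos.2 h.ne_zero) 2
  rw [sq_abs] at this
  nlinarith

end IsContactMetricOn

end Connection

/-! ### Eigenlines of a nonzero trace-free symmetric endomorphism of a plane. -/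

section Shape

variable {V : Type*} [NormedAddCommGroup V] [NormedSpace ℝ V]

/-- `T` is, on the plane `ker φ`, nonzero, symmetric and trace-free in some basis, and `T` kills a
complement of that plane. -/
def IsShape (T : V →L[ℝ] V) (φ : V →L[ℝ] ℝ) : Prop :=
  ∃ (b : Module.Basis (Fin 3) ℝ V) (a c : ℝ), 0 < a ^ 2 + c ^ 2 ∧ T (b 0) = 0 ∧
    T (b 1) = a • b 1 + c • b 2 ∧ T (b 2) = c • b 1 - a • b 2 ∧
    φ (b 0) = 1 ∧ φ (b 1) = 0 ∧ φ (b 2) = 0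

/-- The positive eigenvalue of a trace-free symmetric map of a plane. -/
def shapeEigenvalue (T : V →L[ℝ] V) : ℝ := √(LinearMap.trace ℝ V (T.comp T) / 2)

/-- On an orthonormal frame `hQ2` says `Q f f = -Q e e`, so the coefficients are `a = Q e e` and `c
= Q e f`; both being zero would force `Q = 0`. -/
theorem isShape_inverse_comp [FiniteDimensional ℝ V] (hV : Module.finrank ℝ V = 3)
    {B Q : V →L[ℝ] V →L[ℝ] ℝ} {n : V} (hB : ∀ u v, B u v = B v u)
    (hpos : ∀ v, v ≠ 0 → 0 < B v v) (hn : B n n = 1) (hQ : ∀ u v, Q u v = Q v u)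
    (hQn : ∀ v, Q n v = 0)
    (hQ2 : ∀ u v, B n u = 0 → B n v = 0 →
      Q u u * B v v + B u u * Q v v - 2 * B u v * Q u v = 0) (hQ0 : Q ≠ 0) :
    IsShape (B.inverse.comp Q) (B n) := by
  obtain ⟨e, f, h⟩ := exists_isFrame hV hB hpos hn
  have htr := hQ2 e f h.ne h.nf
  rw [h.ee, h.ff, h.ef] at htr
  have hff : Q f f = - Q e e := by linarith
  have hS : ∀ u v, B v (B.inverse (Q u)) = Q u v := fun u v ↦ by
    rw [hB, apply_inverse_of_pos hpos]
  refine ⟨h.basis hV, Q e e, Q e f, ?_, ?_, ?_, ?_, ?_⟩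
  · by_contra hle
    have h1 : Q e e = 0 := by nlinarith [sq_nonneg (Q e e), sq_nonneg (Q e f)]
    have h2 : Q e f = 0 := by nlinarith [sq_nonneg (Q e e), sq_nonneg (Q e f)]
    refine hQ0 (ContinuousLinearMap.coe_injective ((h.basis hV).ext fun i ↦
      ContinuousLinearMap.coe_injective ((h.basis hV).ext fun j ↦ ?_)))
    rw [h.coe_basis hV]
    fin_cases i <;> fin_cases j <;> simp [hQn, hQ _ n, hQ f e, h1, h2, hff]
  all_goals simp only [h.coe_basis hV]
  · have : Q n = 0 := by ext v; simp [hQn]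
    simp [this]
  · simp only [ContinuousLinearMap.comp_apply, Matrix.cons_val_one, Matrix.cons_val]
    rw [h.expand hV (B.inverse (Q e)), hS, hS, hS, hQ e n, hQn]
    simp
  · simp only [ContinuousLinearMap.comp_apply, Matrix.cons_val_one, Matrix.cons_val]
    rw [h.expand hV (B.inverse (Q f)), hS, hS, hS, hQ f n, hQn, hff, hQ f e]
    simp [sub_eq_add_neg]
  · simp [h.nn, h.ne, h.nf]

namespace IsShape

variable {T : V →L[ℝ] V} {φ : V →L[ℝ] ℝ}

theorem trace_pos (h : IsShape T φ) : 0 < LinearMap.trace ℝ V (T.comp T) := by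
  obtain ⟨b, a, c, hac, h0, h1, h2, -⟩ := h
  rw [LinearMap.trace_eq_matrix_trace ℝ b, Matrix.trace, Fin.sum_univ_three]
  simp only [Matrix.diag_apply, LinearMap.toMatrix_apply, ContinuousLinearMap.coe_coe,
    ContinuousLinearMap.comp_apply, h0, h1, h2, map_add, map_sub, map_smul, map_zero]
  simp
  nlinarith

theorem shapeEigenvalue_pos (h : IsShape T φ) : 0 < shapeEigenvalue T :=
  Real.sqrt_pos.2 (by linarith [h.trace_pos])

theorem map_apply (h : IsShape T φ) (v : V) : φ (T v) = 0 := by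
  obtain ⟨b, a, c, -, h0, h1, h2, -, h4, h5⟩ := h
  have hv := b.sum_repr v
  rw [Fin.sum_univ_three] at hv
  rw [← hv]
  simp [h0, h1, h2, h4, h5]

theorem sq_shapeEigenvalue (h : IsShape T φ) {b : Module.Basis (Fin 3) ℝ V} {a c : ℝ}
    (h0 : T (b 0) = 0) (h1 : T (b 1) = a • b 1 + c • b 2) (h2 : T (b 2) = c • b 1 - a • b 2) :
    shapeEigenvalue T ^ 2 = a ^ 2 + c ^ 2 := by
  rw [shapeEigenvalue, Real.sq_sqrt (by linarith [h.trace_pos]),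
    LinearMap.trace_eq_matrix_trace ℝ b, Matrix.trace, Fin.sum_univ_three]
  simp only [Matrix.diag_apply, LinearMap.toMatrix_apply, ContinuousLinearMap.coe_coe,
    ContinuousLinearMap.comp_apply, h0, h1, h2, map_add, map_sub, map_smul, map_zero]
  simp
  ring

/-- Cayley–Hamilton on the plane: the trace is zero and the determinant is `-(a² + c²)`. -/
theorem apply_apply (h : IsShape T φ) {v : V} (hv : φ v = 0) :
    T (T v) = shapeEigenvalue T ^ 2 • v := by
  obtain ⟨b, a, c, -, h0, h1, h2, h3, h4, h5⟩ := id h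
  rw [h.sq_shapeEigenvalue h0 h1 h2]
  have hr := b.sum_repr v
  rw [Fin.sum_univ_three] at hr
  have hx : b.repr v 0 = 0 := by
    rw [← hr] at hv
    simpa [h3, h4, h5] using hv
  rw [hx] at hr
  rw [← hr]
  simp only [map_add, map_smul, h0, h1, h2, map_sub]
  module

theorem apply_cube (h : IsShape T φ) (v : V) : T (T (T v)) = shapeEigenvalue T ^ 2 • T v :=
  h.apply_apply (h.map_apply v)

/-- `T² + s λ T` maps onto the eigenline for `s λ`. -/
theorem apply_add_smul (h : IsShape T φ) {s : ℝ} (hs : s ^ 2 = 1) (v : V) :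
    T (T (T v) + (s * shapeEigenvalue T) • T v) =
      (s * shapeEigenvalue T) • (T (T v) + (s * shapeEigenvalue T) • T v) := by
  rw [map_add, map_smul, h.apply_cube, smul_add, smul_smul]
  have : s * shapeEigenvalue T * (s * shapeEigenvalue T) = shapeEigenvalue T ^ 2 := by
    linear_combination shapeEigenvalue T ^ 2 * hs
  rw [this, add_comm]

theorem apply_eq_zero_of_eigen (h : IsShape T φ) {s : ℝ} (hs : s ^ 2 = 1) {v : V}
    (hv : T v = (s * shapeEigenvalue T) • v) : φ v = 0 := by
  have h1 := h.map_apply v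
  rw [hv, map_smul, smul_eq_mul] at h1
  have h2 : s * shapeEigenvalue T ≠ 0 :=
    mul_ne_zero (by rintro rfl; norm_num at hs) h.shapeEigenvalue_pos.ne'
  exact (mul_eq_zero.1 h1).resolve_left h2

/-- The eigenvalues `±λ` are distinct on the plane, and any eigenvector for one of them lies in the
plane, so each eigenspace is a line. -/
theorem exists_eq_smul (h : IsShape T φ) {s : ℝ} (hs : s ^ 2 = 1) {u v : V} (hu0 : u ≠ 0)
    (hu : T u = (s * shapeEigenvalue T) • u) (hv : T v = (s * shapeEigenvalue T) • v) :
    ∃ r : ℝ, v = r • u := by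
  have hφu := h.apply_eq_zero_of_eigen hs hu
  have hφv := h.apply_eq_zero_of_eigen hs hv
  obtain ⟨b, a, c, hac, h0, h1, h2, h3, h4, h5⟩ := id h
  have hl := h.sq_shapeEigenvalue h0 h1 h2
  have hlp := h.shapeEigenvalue_pos
  set l := s * shapeEigenvalue T with hldef
  have hl2 : l ^ 2 = a ^ 2 + c ^ 2 := by rw [hldef, mul_pow, hs, one_mul, hl]
  have hl0 : l ≠ 0 := by
    intro h'
    rw [h'] at hl2
    nlinarith
  have coords : ∀ w : V, φ w = 0 → T w = l • w → ∃ x y : ℝ, w = x • b 1 + y • b 2 ∧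
      a * x + c * y = l * x ∧ c * x - a * y = l * y := by
    intro w hw hTw
    have hr := b.sum_repr w
    rw [Fin.sum_univ_three] at hr
    have hx : b.repr w 0 = 0 := by
      rw [← hr] at hw
      simpa [h3, h4, h5] using hw
    rw [hx, zero_smul, zero_add] at hr
    have h6 : b.repr (T w) = l • b.repr w := by rw [hTw, map_smul]
    rw [← hr] at h6
    have h7 := DFunLike.congr_fun h6 1
    have h8 := DFunLike.congr_fun h6 2
    simp [h1, h2] at h7 h8
    exact ⟨b.repr w 1, b.repr w 2, hr.symm, by linarith, by linarith⟩
  obtain ⟨x, y, rfl, e1, e2⟩ := coords u hφu hu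
  obtain ⟨x', y', rfl, e3, e4⟩ := coords v hφv hv
  -- Eliminating `a` and `c` from the four eigenvalue equations leaves `2 l` times the determinant.
  have hdet : x * y' - x' * y = 0 := by
    have : 2 * l * (x * y' - x' * y) = 0 := by
      linear_combination (-y') * e1 + x' * e2 + y * e3 - x * e4
    rcases mul_eq_zero.1 this with h' | h'
    · exact absurd (by linarith) hl0
    · exact h'
  by_cases hx : x = 0
  · have hy : y ≠ 0 := by
      rintro rfl
      exact hu0 (by simp [hx])
    have hx' : x' = 0 := by
      rw [hx] at hdet
      simpa [hy] using hdet
    refine ⟨y' / y, ?_⟩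
    rw [hx, hx', smul_add, smul_smul, smul_smul, div_mul_cancel₀ _ hy]
    simp
  · refine ⟨x' / x, ?_⟩
    rw [smul_add, smul_smul, smul_smul, div_mul_cancel₀ _ hx]
    congr 2
    field_simp
    linarith

/-- Otherwise `T` would be the scalar `-s λ` on the whole plane, whose eigenspaces are lines. The
vector found here yields a local section of the eigenline. -/
theorem exists_add_smul_ne_zero (h : IsShape T φ) {s : ℝ} (hs : s ^ 2 = 1) :
    ∃ v, T (T v) + (s * shapeEigenvalue T) • T v ≠ 0 := by
  by_contra! hall
  obtain ⟨b, a, c, hac, h0, h1, h2, h3, h4, h5⟩ := id h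
  have hl := h.shapeEigenvalue_pos
  have key : ∀ v, φ v = 0 → T v = ((-s) * shapeEigenvalue T) • v := by
    intro v hv
    have h6 := hall v
    rw [h.apply_apply hv] at h6
    have h7 : shapeEigenvalue T • (shapeEigenvalue T • v + s • T v) = 0 := by
      rw [← h6]; module
    have h8 := (smul_eq_zero.1 h7).resolve_left hl.ne'
    have h9 : s • (shapeEigenvalue T • v + s • T v) = 0 := by rw [h8, smul_zero]
    have h10 : T v = s • (shapeEigenvalue T • v + s • T v)
        - (s * shapeEigenvalue T) • v + (1 - s ^ 2) • T v := by module
    rw [h10, h9, hs]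
    module
  obtain ⟨r, hr⟩ := h.exists_eq_smul (s := -s) (by rw [neg_sq, hs]) (b.ne_zero 1) (key _ h4)
    (key _ h5)
  have := DFunLike.congr_fun (congrArg b.repr hr) 2
  simp at this

end IsShape

end Shape

/-! ### Naturality of the Lie derivative of a metric. -/

section Pullback

variable {V : Type*} [NormedAddCommGroup V] [NormedSpace ℝ V]

/-- The Lie derivative of a metric is natural under local diffeomorphisms. -/
theorem lieMetric_pullback {G G' : V → V →L[ℝ] V →L[ℝ] ℝ} {N N' τ : V → V} {x : V}
    (hτ : ContDiffAt ℝ ∞ τ x) (hG : DifferentiableAt ℝ G (τ x)) (hN : DifferentiableAt ℝ N (τ x))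
    (hG' : DifferentiableAt ℝ G' x) (hN' : DifferentiableAt ℝ N' x)
    (h1 : ∀ᶠ y in 𝓝 x, ∀ u v, G' y u v = G (τ y) (fderiv ℝ τ y u) (fderiv ℝ τ y v))
    (h2 : ∀ᶠ y in 𝓝 x, fderiv ℝ τ y (N' y) = N (τ y)) (u v : V) :
    lieMetric G' N' x u v = lieMetric G N (τ x) (fderiv ℝ τ x u) (fderiv ℝ τ x v) := by
  have hτ1 : HasFDerivAt τ (fderiv ℝ τ x) x := (hτ.differentiableAt (by simp)).hasFDerivAt
  have hτ2 : HasFDerivAt (fderiv ℝ τ) (fderiv ℝ (fderiv ℝ τ) x) x :=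
    ((hτ.fderiv_right (m := ∞) (by simp)).differentiableAt (by simp)).hasFDerivAt
  have hsym : IsSymmSndFDerivAt ℝ τ x :=
    hτ.isSymmSndFDerivAt (by simpa using WithTop.coe_le_coe.2 (le_top (a := (2 : ℕ∞))))
  have hc : ∀ w : V, HasFDerivAt (fun _ : V ↦ w) (0 : V →L[ℝ] V) x :=
    fun w ↦ hasFDerivAt_const w x
  have e1 := ((hG'.hasFDerivAt.clm_apply (hc u)).clm_apply (hc v)).unique
    ((((hG.hasFDerivAt.comp x hτ1).clm_apply (hτ2.clm_apply (hc u))).clm_apply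
      (hτ2.clm_apply (hc v))).congr_of_eventuallyEq (by
        filter_upwards [h1] with y hy using hy u v))
  have e2 : ∀ w, fderiv ℝ (fderiv ℝ τ) x w (N' x) + fderiv ℝ τ x (fderiv ℝ N' x w) =
      fderiv ℝ N (τ x) (fderiv ℝ τ x w) := by
    intro w
    have := congrArg (fun L ↦ L w) ((hτ2.clm_apply hN'.hasFDerivAt).unique
      ((hN.hasFDerivAt.comp x hτ1).congr_of_eventuallyEq h2))
    simp at this
    rw [← this, add_comm]
  have e3 := congrArg (fun L ↦ L (N' x)) e1
  simp at e3
  -- The terms with second derivatives of `τ` coming from the metric (`e3`) and from the field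
  -- (`e2`) cancel by symmetry of the second derivative.
  rw [lieMetric_apply, lieMetric_apply, e3, ← e2, ← e2, h1.self_of_nhds, h1.self_of_nhds,
    h2.self_of_nhds, hsym.eq (N' x) u, hsym.eq (N' x) v]
  simp only [map_add, _root_.add_apply]
  ring

end Pullback

/-! ### Charts, their derivatives and coordinate fields. -/

section Charts

variable {M : Type*} [TopologicalSpace M] [ChartedSpace E3 M]

/-- The derivative at `q` of the preferred chart at `p`. -/
def chartDeriv (p q : M) : TangentSpace (𝓡 3) q →L[ℝ] E3 :=
  mfderiv (𝓡 3) 𝓘(ℝ, E3) (extChartAt (𝓡 3) p) q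

/-- The derivative at `y` of the inverse of the preferred chart at `p`. -/
def chartSymmDeriv (p : M) (y : E3) : E3 →L[ℝ] TangentSpace (𝓡 3) ((extChartAt (𝓡 3) p).symm y) :=
  mfderiv 𝓘(ℝ, E3) (𝓡 3) (extChartAt (𝓡 3) p).symm y

/-- The vector field whose expression in the preferred chart at `p` is `F`. -/
def chartField (p : M) (F : E3 → E3) (q : M) : TangentSpace (𝓡 3) q :=
  mpullback (𝓡 3) 𝓘(ℝ, E3) (extChartAt (𝓡 3) p) (fun y ↦ F y) q

variable [IsManifold (𝓡 3) ∞ M]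

omit [IsManifold (𝓡 3) ∞ M] in
theorem exists_chart_symm_eq {p q : M} (hq : q ∈ (extChartAt (𝓡 3) p).source) :
    ∃ y ∈ (extChartAt (𝓡 3) p).target, (extChartAt (𝓡 3) p).symm y = q :=
  ⟨_, (extChartAt (𝓡 3) p).map_source hq, (extChartAt (𝓡 3) p).left_inv hq⟩

variable {p : M} {y : E3}

theorem chartDeriv_chartSymmDeriv (hy : y ∈ (extChartAt (𝓡 3) p).target) (v : E3) :
    chartDeriv p ((extChartAt (𝓡 3) p).symm y) (chartSymmDeriv p y v) = v := by
  have : IsManifold (𝓡 3) 1 M := .of_le (n := ∞) (by simp)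
  have h := mfderiv_extChartAt_comp_mfderivWithin_extChartAt_symm (I := 𝓡 3) hy
  rw [ModelWithCorners.range_eq_univ, mfderivWithin_univ] at h
  exact congrArg (fun L ↦ L v) h

theorem chartSymmDeriv_chartDeriv (hy : y ∈ (extChartAt (𝓡 3) p).target)
    (w : TangentSpace (𝓡 3) ((extChartAt (𝓡 3) p).symm y)) :
    chartSymmDeriv p y (chartDeriv p ((extChartAt (𝓡 3) p).symm y) w) = w := by
  have : IsManifold (𝓡 3) 1 M := .of_le (n := ∞) (by simp)
  have h := mfderivWithin_extChartAt_symm_comp_mfderiv_extChartAt (I := 𝓡 3) hy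
  rw [ModelWithCorners.range_eq_univ, mfderivWithin_univ] at h
  exact congrArg (fun L ↦ L w) h

theorem isInvertible_chartDeriv {q : M} (hq : q ∈ (extChartAt (𝓡 3) p).source) :
    (chartDeriv p q).IsInvertible := by
  have : IsManifold (𝓡 3) 1 M := .of_le (n := ∞) (by simp)
  exact isInvertible_mfderiv_extChartAt (I := 𝓡 3) hq

omit [IsManifold (𝓡 3) ∞ M] in
theorem chartField_eq (p : M) (F : E3 → E3) (q : M) :
    chartField p F q = (chartDeriv p q).inverse (F (extChartAt (𝓡 3) p q)) := rfl

theorem chartDeriv_chartField {q : M} (hq : q ∈ (extChartAt (𝓡 3) p).source) (F : E3 → E3) :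
    chartDeriv p q (chartField p F q) = F (extChartAt (𝓡 3) p q) := by
  rw [chartField_eq]
  obtain ⟨e, he⟩ := isInvertible_chartDeriv hq
  rw [← he]
  simp

theorem chartField_chart_symm (hy : y ∈ (extChartAt (𝓡 3) p).target) (F : E3 → E3) :
    chartField p F ((extChartAt (𝓡 3) p).symm y) = chartSymmDeriv p y (F y) := by
  rw [← chartSymmDeriv_chartDeriv hy (chartField p F _),
    chartDeriv_chartField ((extChartAt (𝓡 3) p).map_target hy),
    (extChartAt (𝓡 3) p).right_inv hy]

theorem chartDeriv_injective {q : M} (hq : q ∈ (extChartAt (𝓡 3) p).source) :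
    Function.Injective (chartDeriv p q) := by
  obtain ⟨e, he⟩ := isInvertible_chartDeriv hq
  rw [← he]
  exact e.injective

theorem contMDiffAt_chartField {F : E3 → E3} {q : M} (hq : q ∈ (extChartAt (𝓡 3) p).source)
    (hF : ContDiffAt ℝ ∞ F (extChartAt (𝓡 3) p q)) :
    ContMDiffAt (𝓡 3) ((𝓡 3).prod 𝓘(ℝ, E3)) ∞
      (fun q ↦ TotalSpace.mk' E3 (E := fun q : M ↦ TangentSpace (𝓡 3) q) q (chartField p F q))
      q := by
  have hφ : ContMDiffAt (𝓡 3) 𝓘(ℝ, E3) ∞ (extChartAt (𝓡 3) p) q :=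
    contMDiffAt_extChartAt' (by simpa using hq)
  refine ContMDiffAt.mpullback_vectorField_preimage (n := ∞) ?_ hφ
    (isInvertible_chartDeriv hq) (by simp)
  exact (contMDiffAt_vectorSpace_iff_contDiffAt (V := fun y ↦ F y)).2 hF

theorem smoothVectorFieldOn_chartField {F : E3 → E3} {U : Set M}
    (hU : U ⊆ (extChartAt (𝓡 3) p).source)
    (hF : ∀ q ∈ U, ContDiffAt ℝ ∞ F (extChartAt (𝓡 3) p q)) :
    SmoothVectorFieldOn (chartField p F) U := fun q hq ↦
  (contMDiffAt_chartField (hU hq) (hF q hq)).contMDiffWithinAt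

/-- Coordinate fields commute: the bracket is the pullback of the bracket of constant fields. It
removes the bracket term from `dForm` in a chart. -/
theorem mlieBracket_chartField_const {q : M} (hq : q ∈ (extChartAt (𝓡 3) p).source) (u v : E3) :
    mlieBracket (𝓡 3) (chartField p fun _ ↦ u) (chartField p fun _ ↦ v) q = 0 := by
  have hφ : ContMDiffAt (𝓡 3) 𝓘(ℝ, E3) ∞ (extChartAt (𝓡 3) p) q :=
    contMDiffAt_extChartAt' (by simpa using hq)
  have hc : ∀ w : E3, MDifferentiableAt 𝓘(ℝ, E3) 𝓘(ℝ, E3).tangent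
      (fun y : E3 ↦ TotalSpace.mk' E3 (E := fun y : E3 ↦ TangentSpace 𝓘(ℝ, E3) y) y w)
      (extChartAt (𝓡 3) p q) := fun w ↦
    ((contMDiffAt_vectorSpace_iff_contDiffAt (n := ∞) (V := fun _ ↦ w)).2
      contDiffAt_const).mdifferentiableAt (by simp)
  have : IsManifold (𝓡 3) (minSmoothness ℝ 2) M :=
    .of_le (n := ∞) (by simpa using WithTop.coe_le_coe.2 (le_top (a := (2 : ℕ∞))))
  have := mpullback_mlieBracket (I := 𝓡 3) (hc u) (hc v) hφ
    (by simpa using WithTop.coe_le_coe.2 (le_top (a := (2 : ℕ∞))))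
  have h2 : mpullback (𝓡 3) 𝓘(ℝ, E3) (extChartAt (𝓡 3) p)
      (mlieBracket 𝓘(ℝ, E3) (fun _ ↦ u) (fun _ ↦ v)) q = 0 := by
    have h3 : mlieBracket 𝓘(ℝ, E3) (fun _ : E3 ↦ u) (fun _ ↦ v) (extChartAt (𝓡 3) p q)
        = (0 : E3) := by
      have h4 := congrFun (mlieBracketWithin_eq_lieBracketWithin (𝕜 := ℝ) (E := E3)
        (V := fun _ ↦ u) (W := fun _ ↦ v) (s := univ)) (extChartAt (𝓡 3) p q)
      refine h4.trans ?_
      rw [lieBracketWithin]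
      erw [fderivWithin_const_apply, fderivWithin_const_apply]
      simp
      rfl
    exact (congrArg (mfderiv (𝓡 3) 𝓘(ℝ, E3) (extChartAt (𝓡 3) p) q).inverse h3).trans
      (map_zero _)
  rw [h2] at this
  exact this.symm

end Charts

/-! ### One-forms, metrics and exterior derivatives read in charts. -/

section FormsInCharts

variable {M : Type*} [TopologicalSpace M] [ChartedSpace E3 M]

/-- A one-form read in the preferred chart at `p`. -/
def formInChart (α : ∀ p : M, TangentSpace (𝓡 3) p →L[ℝ] ℝ) (p : M) (y : E3) : E3 →L[ℝ] ℝ :=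
  (α ((extChartAt (𝓡 3) p).symm y)).comp (chartSymmDeriv p y)

theorem formInChart_apply (α : ∀ p : M, TangentSpace (𝓡 3) p →L[ℝ] ℝ) (p : M) (y v : E3) :
    formInChart α p y v = α ((extChartAt (𝓡 3) p).symm y) (chartSymmDeriv p y v) := rfl

variable [IsManifold (𝓡 3) ∞ M] {p : M} {y : E3}

theorem metricInChart_apply (g : Metric M) (p : M) (y u v : E3) :
    metricInChart g p y u v = g.inner ((extChartAt (𝓡 3) p).symm y) (chartSymmDeriv p y u)
      (chartSymmDeriv p y v) := rfl

theorem contDiffOn_comp_chart_symm {f : M → ℝ}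
    (hf : ∀ q ∈ (extChartAt (𝓡 3) p).source, ContMDiffAt (𝓡 3) 𝓘(ℝ, ℝ) ∞ f q) :
    ContDiffOn ℝ ∞ (fun y ↦ f ((extChartAt (𝓡 3) p).symm y)) (extChartAt (𝓡 3) p).target := by
  rw [← contMDiffOn_iff_contDiffOn]
  intro y hy
  exact (hf _ ((extChartAt (𝓡 3) p).map_target hy)).comp_contMDiffWithinAt y
    (contMDiffOn_extChartAt_symm p y hy)

theorem contMDiffAt_form_apply {α : ∀ p : M, TangentSpace (𝓡 3) p →L[ℝ] ℝ}
    {X : ∀ p : M, TangentSpace (𝓡 3) p} {q : M}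
    (hα : ContMDiffAt (𝓡 3) ((𝓡 3).prod 𝓘(ℝ, E3 →L[ℝ] ℝ)) ∞
      (fun p ↦ TotalSpace.mk' (E3 →L[ℝ] ℝ)
        (E := fun q : M ↦ TangentSpace (𝓡 3) q →L[ℝ] Trivial M ℝ q) p (α p)) q)
    (hX : ContMDiffAt (𝓡 3) ((𝓡 3).prod 𝓘(ℝ, E3)) ∞
      (fun p ↦ TotalSpace.mk' E3 (E := fun q : M ↦ TangentSpace (𝓡 3) q) p (X p)) q) :
    ContMDiffAt (𝓡 3) 𝓘(ℝ, ℝ) ∞ (fun q ↦ α q (X q)) q := by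
  have := ContMDiffAt.clm_bundle_apply (F₁ := E3) (F₂ := ℝ)
    (E₁ := fun q : M ↦ TangentSpace (𝓡 3) q) (E₂ := Trivial M ℝ) (b := fun q : M ↦ q)
    (ϕ := fun q ↦ α q) (v := X) hα hX
  rw [contMDiffAt_section] at this
  simpa using this

theorem contMDiffAt_metric_apply (g : Metric M) {X Y : ∀ p : M, TangentSpace (𝓡 3) p} {q : M}
    (hX : ContMDiffAt (𝓡 3) ((𝓡 3).prod 𝓘(ℝ, E3)) ∞
      (fun p ↦ TotalSpace.mk' E3 (E := fun q : M ↦ TangentSpace (𝓡 3) q) p (X p)) q)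
    (hY : ContMDiffAt (𝓡 3) ((𝓡 3).prod 𝓘(ℝ, E3)) ∞
      (fun p ↦ TotalSpace.mk' E3 (E := fun q : M ↦ TangentSpace (𝓡 3) q) p (Y p)) q) :
    ContMDiffAt (𝓡 3) 𝓘(ℝ, ℝ) ∞ (fun q ↦ g.inner q (X q) (Y q)) q := by
  have := ContMDiffAt.clm_bundle_apply (F₁ := E3) (F₂ := E3 →L[ℝ] ℝ)
    (E₁ := fun q : M ↦ TangentSpace (𝓡 3) q)
    (E₂ := fun q : M ↦ TangentSpace (𝓡 3) q →L[ℝ] Trivial M ℝ q) (b := fun q : M ↦ q)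
    (ϕ := fun q ↦ g.inner q) (v := X) (g.contMDiff q) hX
  exact contMDiffAt_form_apply (α := fun q ↦ g.inner q (X q)) this hY

theorem contDiffOn_formInChart {α : ∀ p : M, TangentSpace (𝓡 3) p →L[ℝ] ℝ}
    (hα : SmoothOneFormOn α univ) (p : M) :
    ContDiffOn ℝ ∞ (formInChart α p) (extChartAt (𝓡 3) p).target := by
  rw [contDiffOn_clm_apply]
  intro v
  refine (contDiffOn_comp_chart_symm (p := p) (f := fun q ↦ α q (chartField p (fun _ ↦ v) q))
    fun q hq ↦ contMDiffAt_form_apply ?_ (contMDiffAt_chartField hq contDiffAt_const)).congr ?_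
  · exact (hα q (mem_univ q)).contMDiffAt Filter.univ_mem
  · intro y hy
    rw [chartField_chart_symm hy, formInChart_apply]

theorem contDiffOn_metricInChart (g : Metric M) (p : M) :
    ContDiffOn ℝ ∞ (metricInChart g p) (extChartAt (𝓡 3) p).target := by
  rw [contDiffOn_clm_apply]
  intro u
  rw [contDiffOn_clm_apply]
  intro v
  refine (contDiffOn_comp_chart_symm (p := p)
    (f := fun q ↦ g.inner q (chartField p (fun _ ↦ u) q) (chartField p (fun _ ↦ v) q))
    fun q hq ↦ contMDiffAt_metric_apply g (contMDiffAt_chartField hq contDiffAt_const)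
      (contMDiffAt_chartField hq contDiffAt_const)).congr ?_
  intro y hy
  rw [chartField_chart_symm hy, chartField_chart_symm hy, metricInChart_apply]

theorem mvfderiv_form_chartField {α : ∀ p : M, TangentSpace (𝓡 3) p →L[ℝ] ℝ}
    (hα : SmoothOneFormOn α univ) (hy : y ∈ (extChartAt (𝓡 3) p).target) (u v : E3) :
    mvfderiv (𝓡 3) (fun q ↦ α q (chartField p (fun _ ↦ v) q)) ((extChartAt (𝓡 3) p).symm y)
      (chartSymmDeriv p y u) = fderiv ℝ (formInChart α p) y u v := by
  have hq := (extChartAt (𝓡 3) p).map_target hy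
  have h1 : MDifferentiableAt (𝓡 3) 𝓘(ℝ, ℝ) (fun q ↦ α q (chartField p (fun _ ↦ v) q))
      ((extChartAt (𝓡 3) p).symm y) :=
    (contMDiffAt_form_apply ((hα _ (mem_univ _)).contMDiffAt Filter.univ_mem)
      (contMDiffAt_chartField hq contDiffAt_const)).mdifferentiableAt (by simp)
  have hU : (extChartAt (𝓡 3) p).target ∈ 𝓝 y := (isOpen_extChartAt_target p).mem_nhds hy
  have h2 : MDifferentiableAt 𝓘(ℝ, E3) (𝓡 3) (extChartAt (𝓡 3) p).symm y :=
    ((contMDiffOn_extChartAt_symm (n := ∞) p y hy).contMDiffAt hU).mdifferentiableAt (by simp)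
  have h3 := mfderiv_comp y h1 h2
  have h4 : (fun q ↦ α q (chartField p (fun _ ↦ v) q)) ∘ (extChartAt (𝓡 3) p).symm
      =ᶠ[𝓝 y] fun z ↦ formInChart α p z v := by
    filter_upwards [hU] with z hz
    rw [Function.comp_apply, chartField_chart_symm hz, formInChart_apply]
  rw [h4.mfderiv_eq, mfderiv_eq_fderiv] at h3
  rw [← fderiv_clm_const_apply (((contDiffOn_formInChart hα p).contDiffAt hU).differentiableAt
    (by simp))]
  exact (congrArg (fun L ↦ L u) h3).symm

/-- The exterior derivative of a one-form in a chart. -/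
theorem dForm_chart {α : ∀ p : M, TangentSpace (𝓡 3) p →L[ℝ] ℝ}
    (hα : SmoothOneFormOn α univ) (hy : y ∈ (extChartAt (𝓡 3) p).target) (u v : E3) :
    dForm α ((extChartAt (𝓡 3) p).symm y) (chartSymmDeriv p y u) (chartSymmDeriv p y v) =
      extDer (formInChart α p) y u v := by
  have hq := (extChartAt (𝓡 3) p).map_target hy
  have hd : ∀ w : E3, DifferentiableFieldAt (chartField p fun _ ↦ w)
      ((extChartAt (𝓡 3) p).symm y) := fun w ↦
    (contMDiffAt_chartField hq contDiffAt_const).mdifferentiableAt (by simp)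
  have h := dForm_apply (((hα _ (mem_univ _)).contMDiffAt Filter.univ_mem).mdifferentiableAt
    (by simp)) (hd u) (hd v)
  rw [chartField_chart_symm hy, chartField_chart_symm hy] at h
  rw [h, dOnFields, mlieBracket_chartField_const hq, map_zero, sub_zero, chartField_chart_symm hy,
    chartField_chart_symm hy, mvfderiv_form_chartField hα hy, mvfderiv_form_chartField hα hy,
    extDer_apply]

end FormsInCharts

/-! ### From the almost complex structure to the area identity. -/

section AlmostComplex

variable {V : Type*} [NormedAddCommGroup V] [NormedSpace ℝ V]

/-- `J` need not be assumed orthogonal. For `k ≠ 0`, skewness of `Ω` gives `J e ∥ f` and `J f ∥ e`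
with opposite coefficients, and `J² = -1` makes these coefficients `±1`. Hence `Ω(e, f)² = k²`, and
the general case follows by expanding in the frame. -/
theorem area_of_almostComplex (hV : Module.finrank ℝ V = 3) {B Ω : V →L[ℝ] V →L[ℝ] ℝ}
    {J : V → V} {n : V} {k : ℝ} (hB : ∀ u v, B u v = B v u)
    (hpos : ∀ v, v ≠ 0 → 0 < B v v) (hn : B n n = 1) (hskew : ∀ u v, Ω u v = - Ω v u)
    (hΩn : ∀ v, Ω n v = 0) (hJs : ∀ (r : ℝ) v, J (r • v) = r • J v)
    (hJ : ∀ v, B n v = 0 → B n (J v) = 0 ∧ J (J v) = -v)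
    (hk : ∀ u v, k * B u (J v) = Ω u v) (u v : V) :
    Ω u v ^ 2 = k ^ 2 * ((B u u - B n u ^ 2) * (B v v - B n v ^ 2)
      - (B u v - B n u * B n v) ^ 2) := by
  obtain ⟨e, f, h⟩ := exists_isFrame hV hB hpos hn
  have hself : ∀ w, Ω w w = 0 := fun w ↦ by linarith [hskew w w]
  have hef : Ω e f ^ 2 = k ^ 2 := by
    rcases eq_or_ne k 0 with rfl | hk0
    · rw [← hk]; ring
    have h1 : B e (J e) = 0 := by
      have := hk e e
      rw [hself] at this
      exact (mul_eq_zero.1 this).resolve_left hk0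
    have h2 : B f (J f) = 0 := by
      have := hk f f
      rw [hself] at this
      exact (mul_eq_zero.1 this).resolve_left hk0
    have hJe : J e = B f (J e) • f := by
      conv_lhs => rw [h.expand hV (J e), h1, (hJ e h.ne).1]
      simp
    have hJf : J f = B e (J f) • e := by
      conv_lhs => rw [h.expand hV (J f), h2, (hJ f h.nf).1]
      simp
    have h3 := congrArg (B e) (hJ e h.ne).2
    rw [hJe, hJs, hJf] at h3
    simp [h.ee] at h3
    have h4 := hk e f
    have h5 := hk f e
    rw [hskew] at h5
    have h6 : B f (J e) = - B e (J f) := by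
      refine mul_left_cancel₀ hk0 ?_
      linarith
    rw [h6] at h3
    rw [← h4]
    linear_combination (-k ^ 2) * h3
  have hn' : ∀ w, Ω w n = 0 := fun w ↦ by rw [hskew, hΩn, neg_zero]
  obtain ⟨x, y, z, rfl⟩ : ∃ x y z : ℝ, u = x • n + y • e + z • f := ⟨_, _, _, h.expand hV u⟩
  obtain ⟨x', y', z', rfl⟩ : ∃ x y z : ℝ, v = x • n + y • e + z • f := ⟨_, _, _, h.expand hV v⟩
  simp only [map_add, map_smul, _root_.add_apply, _root_.smul_apply, smul_eq_mul, hΩn, hn', hself,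
    hskew f e, h.nn, h.ee, h.ff, h.ne, h.nf, h.ef, h.en, h.fn, h.fe]
  linear_combination (y * z' - y' * z) ^ 2 * hef

end AlmostComplex

/-! ### A compatible metric gives a contact metric in every chart. -/

section Compatible

variable {M : Type*} [TopologicalSpace M] [ChartedSpace E3 M]

/-- A vector field read in the preferred chart at `p`. -/
def fieldInChart (N : ∀ p : M, TangentSpace (𝓡 3) p) (p : M) (y : E3) : E3 :=
  chartDeriv p ((extChartAt (𝓡 3) p).symm y) (N ((extChartAt (𝓡 3) p).symm y))

variable [IsManifold (𝓡 3) ∞ M] {p : M} {y : E3}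

theorem chartSymmDeriv_fieldInChart (N : ∀ p : M, TangentSpace (𝓡 3) p)
    (hy : y ∈ (extChartAt (𝓡 3) p).target) :
    chartSymmDeriv p y (fieldInChart N p y) = N ((extChartAt (𝓡 3) p).symm y) :=
  chartSymmDeriv_chartDeriv hy _

theorem chartSymmDeriv_ne_zero (hy : y ∈ (extChartAt (𝓡 3) p).target) {v : E3} (hv : v ≠ 0) :
    chartSymmDeriv p y v ≠ 0 := by
  intro h
  have := chartDeriv_chartSymmDeriv hy v
  rw [h, map_zero] at this
  exact hv this.symm

theorem metricInChart_pos (g : Metric M) (hy : y ∈ (extChartAt (𝓡 3) p).target) {v : E3}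
    (hv : v ≠ 0) : 0 < metricInChart g p y v v :=
  g.pos _ _ (chartSymmDeriv_ne_zero hy hv)

theorem isContactMetricOn_chart {ξ : ∀ p : M, Submodule ℝ (TangentSpace (𝓡 3) p)} {g : Metric M}
    {α : ∀ p : M, TangentSpace (𝓡 3) p →L[ℝ] ℝ} {N : ∀ p : M, TangentSpace (𝓡 3) p}
    {J : ∀ p : M, TangentSpace (𝓡 3) p →L[ℝ] TangentSpace (𝓡 3) p} {k : ℝ}
    (hα : IsContactFormForOn α ξ univ) (hN : IsReebField α N)
    (hJ : ∀ p : M, ∀ v ∈ ξ p, J p v ∈ ξ p ∧ J p (J p v) = -v)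
    (hg : ∀ (p : M) (u : TangentSpace (𝓡 3) p), g.inner p (N p) u = α p u)
    (hk : ∀ (p : M) (u v : TangentSpace (𝓡 3) p), k * g.inner p u (J p v) = dForm α p u v)
    (p : M) :
    IsContactMetricOn (metricInChart g p) (fieldInChart N p) k (extChartAt (𝓡 3) p).target := by
  have hV : Module.finrank ℝ E3 = 3 := by simp
  have hdual : ∀ y ∈ (extChartAt (𝓡 3) p).target,
      dualForm (metricInChart g p) (fieldInChart N p) y = formInChart α p y := by
    intro y hy
    ext v
    rw [dualForm, metricInChart_apply, chartSymmDeriv_fieldInChart N hy, hg, formInChart_apply]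
  have hext : ∀ y ∈ (extChartAt (𝓡 3) p).target,
      extDer (dualForm (metricInChart g p) (fieldInChart N p)) y
        = extDer (formInChart α p) y := by
    intro y hy
    have : dualForm (metricInChart g p) (fieldInChart N p) =ᶠ[𝓝 y] formInChart α p := by
      filter_upwards [(isOpen_extChartAt_target p).mem_nhds hy] with z hz using hdual z hz
    rw [extDer, extDer, this.fderiv_eq]
  have hreeb : ∀ y ∈ (extChartAt (𝓡 3) p).target, ∀ v,
      extDer (formInChart α p) y (fieldInChart N p y) v = 0 := by
    intro y hy v
    rw [← dForm_chart hα.1 hy, chartSymmDeriv_fieldInChart N hy]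
    exact (hN _).2 _
  have hsymm : ∀ y u v, metricInChart g p y u v = metricInChart g p y v u :=
    fun y u v ↦ g.symm _ _ _
  have hunit : ∀ y ∈ (extChartAt (𝓡 3) p).target,
      metricInChart g p y (fieldInChart N p y) (fieldInChart N p y) = 1 := by
    intro y hy
    rw [metricInChart_apply, chartSymmDeriv_fieldInChart N hy, hg]
    exact (hN _).1
  refine ⟨isOpen_extChartAt_target p, contDiffOn_metricInChart g p, ?_, fun y _ ↦ hsymm y,
    fun y hy v hv ↦ metricInChart_pos g hy hv, hunit, ?_, ?_, ?_⟩
  -- Smoothness of the Reeb field is deduced: it is the metric dual of `α`, that is `G⁻¹ α`.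
  · have : CompleteSpace E3 := FiniteDimensional.complete ℝ E3
    intro y hy
    have hU := (isOpen_extChartAt_target p).mem_nhds hy
    have hinv := ((contDiffOn_metricInChart g p).contDiffAt hU).clm_inverse
      (isInvertible_of_pos fun v hv ↦ metricInChart_pos g hy hv)
    refine ((hinv.clm_apply ((contDiffOn_formInChart hα.1 p).contDiffAt hU)).congr_of_eventuallyEq
      ?_).contDiffWithinAt
    filter_upwards [hU] with z hz
    obtain ⟨e, he⟩ := isInvertible_of_pos fun v hv ↦ metricInChart_pos g hz hv
    rw [← hdual z hz, dualForm, ← he]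
    simp
  · intro y hy v
    rw [hext y hy, hreeb y hy]
  · intro y hy u v
    rw [hext y hy]
    have hmem : ∀ w : E3, metricInChart g p y (fieldInChart N p y) w = 0 ↔
        chartSymmDeriv p y w ∈ ξ ((extChartAt (𝓡 3) p).symm y) := by
      intro w
      rw [(hα.2 _ (mem_univ _)).2, metricInChart_apply, chartSymmDeriv_fieldInChart N hy, hg]
    refine area_of_almostComplex hV (J := fun w ↦ chartDeriv p ((extChartAt (𝓡 3) p).symm y)
      (J _ (chartSymmDeriv p y w))) (hsymm y) (fun v hv ↦ metricInChart_pos g hy hv) (hunit y hy)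
      ?_ (hreeb y hy) ?_ ?_ ?_ u v
    · intro u v
      simp [extDer_apply]
    · intro r v
      rw [map_smul, map_smul, map_smul]
    · intro v hv
      have h1 := hJ _ _ ((hmem v).1 hv)
      rw [hmem, chartSymmDeriv_chartDeriv hy]
      refine ⟨h1.1, ?_⟩
      rw [h1.2, map_neg, chartDeriv_chartSymmDeriv hy]
    · intro u v
      rw [metricInChart_apply, chartSymmDeriv_chartDeriv hy, hk, dForm_chart hα.1 hy]
  -- `k = 0` would give `dα = 0`, against `α ∧ dα ≠ 0`.
  · rintro rfl
    obtain ⟨u, v, w, huvw⟩ := (hα.2 p (mem_univ p)).1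
    simp [← hk] at huvw

end Compatible

/-! ### Independence of the chart. -/

section Transition

variable {M : Type*} [TopologicalSpace M] [ChartedSpace E3 M] [IsManifold (𝓡 3) ∞ M]

theorem metricInChart_chartDeriv (g : Metric M) {p q : M}
    (hq : q ∈ (extChartAt (𝓡 3) p).source) (u v : TangentSpace (𝓡 3) q) :
    metricInChart g p (extChartAt (𝓡 3) p q) (chartDeriv p q u) (chartDeriv p q v) =
      g.inner q u v := by
  obtain ⟨y, hy, rfl⟩ := exists_chart_symm_eq hq
  rw [(extChartAt (𝓡 3) p).right_inv hy, metricInChart_apply, chartSymmDeriv_chartDeriv hy,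
    chartSymmDeriv_chartDeriv hy]

omit [IsManifold (𝓡 3) ∞ M] in
theorem fieldInChart_chart (N : ∀ p : M, TangentSpace (𝓡 3) p) {p q : M}
    (hq : q ∈ (extChartAt (𝓡 3) p).source) :
    fieldInChart N p (extChartAt (𝓡 3) p q) = chartDeriv p q (N q) := by
  obtain ⟨y, hy, rfl⟩ := exists_chart_symm_eq hq
  rw [(extChartAt (𝓡 3) p).right_inv hy, fieldInChart]

theorem contDiffAt_transition {p p' : M} {y : E3} (hy : y ∈ (extChartAt (𝓡 3) p').target)
    (hq : (extChartAt (𝓡 3) p').symm y ∈ (extChartAt (𝓡 3) p).source) :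
    ContDiffAt ℝ ∞ (extChartAt (𝓡 3) p ∘ (extChartAt (𝓡 3) p').symm) y := by
  rw [← contMDiffAt_iff_contDiffAt]
  have h1 : ContMDiffAt (𝓡 3) 𝓘(ℝ, E3) ∞ (extChartAt (𝓡 3) p) ((extChartAt (𝓡 3) p').symm y) :=
    contMDiffAt_extChartAt' (by simpa using hq)
  exact h1.comp y ((contMDiffOn_extChartAt_symm p' y hy).contMDiffAt
    ((isOpen_extChartAt_target p').mem_nhds hy))

theorem fderiv_transition {p p' : M} {y : E3} (hy : y ∈ (extChartAt (𝓡 3) p').target)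
    (hq : (extChartAt (𝓡 3) p').symm y ∈ (extChartAt (𝓡 3) p).source) (v : E3) :
    fderiv ℝ (extChartAt (𝓡 3) p ∘ (extChartAt (𝓡 3) p').symm) y v =
      chartDeriv p ((extChartAt (𝓡 3) p').symm y) (chartSymmDeriv p' y v) := by
  have h1 : MDifferentiableAt (𝓡 3) 𝓘(ℝ, E3) (extChartAt (𝓡 3) p)
      ((extChartAt (𝓡 3) p').symm y) :=
    (contMDiffAt_extChartAt' (n := ∞) (by simpa using hq)).mdifferentiableAt (by simp)
  have h2 : MDifferentiableAt 𝓘(ℝ, E3) (𝓡 3) (extChartAt (𝓡 3) p').symm y :=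
    ((contMDiffOn_extChartAt_symm (n := ∞) p' y hy).contMDiffAt
      ((isOpen_extChartAt_target p').mem_nhds hy)).mdifferentiableAt (by simp)
  have h3 := mfderiv_comp y h1 h2
  rw [mfderiv_eq_fderiv] at h3
  exact congrArg (fun L ↦ L v) h3

/-- `lieMetric_pullback` for the transition map: `L_N g` is a well-defined tensor on `M`, so its
vanishing and its eigenlines do not depend on the chart. -/
theorem lieMetric_transition {g : Metric M} {N : ∀ p : M, TangentSpace (𝓡 3) p} {k : ℝ}
    (hloc : ∀ p, IsContactMetricOn (metricInChart g p) (fieldInChart N p) k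
      (extChartAt (𝓡 3) p).target) {p p' q : M} (hq : q ∈ (extChartAt (𝓡 3) p).source)
    (hq' : q ∈ (extChartAt (𝓡 3) p').source) (u v : TangentSpace (𝓡 3) q) :
    lieMetric (metricInChart g p') (fieldInChart N p') (extChartAt (𝓡 3) p' q)
      (chartDeriv p' q u) (chartDeriv p' q v) =
    lieMetric (metricInChart g p) (fieldInChart N p) (extChartAt (𝓡 3) p q)
      (chartDeriv p q u) (chartDeriv p q v) := by
  obtain ⟨y, hy, rfl⟩ := exists_chart_symm_eq hq'
  have hy2 := (extChartAt (𝓡 3) p).map_source hq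
  rw [(extChartAt (𝓡 3) p').right_inv hy]
  have hev : ∀ᶠ z in 𝓝 y, z ∈ (extChartAt (𝓡 3) p').target ∧
      (extChartAt (𝓡 3) p').symm z ∈ (extChartAt (𝓡 3) p).source := by
    refine ((isOpen_extChartAt_target p').eventually_mem hy).and ?_
    exact (continuousAt_extChartAt_symm'' hy).eventually_mem
      ((isOpen_extChartAt_source p).mem_nhds hq)
  have h := lieMetric_pullback (G := metricInChart g p) (G' := metricInChart g p')
    (N := fieldInChart N p) (N' := fieldInChart N p') (contDiffAt_transition hy hq)
    (((hloc p).contDiffAt_metric hy2).differentiableAt (by simp))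
    (((hloc p).contDiffAt_reeb hy2).differentiableAt (by simp))
    (((hloc p').contDiffAt_metric hy).differentiableAt (by simp))
    (((hloc p').contDiffAt_reeb hy).differentiableAt (by simp)) ?_ ?_
    (chartDeriv p' _ u) (chartDeriv p' _ v)
  · rw [h, fderiv_transition hy hq, fderiv_transition hy hq, chartSymmDeriv_chartDeriv hy,
      chartSymmDeriv_chartDeriv hy]
    rfl
  · filter_upwards [hev] with z hz a b
    rw [fderiv_transition hz.1 hz.2, fderiv_transition hz.1 hz.2, Function.comp_apply,
      metricInChart_chartDeriv g hz.2, metricInChart_apply]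
  · filter_upwards [hev] with z hz
    rw [fderiv_transition hz.1 hz.2, Function.comp_apply, fieldInChart_chart N hz.2,
      chartSymmDeriv_fieldInChart N hz.1]

end Transition

/-! ### Nonpositive curvature forces `L_N g` to vanish nowhere. -/

section Curvature

variable {M : Type*} [TopologicalSpace M] [ChartedSpace E3 M] [IsManifold (𝓡 3) ∞ M]

theorem riemann_eq_curvatureAt (G : E3 → E3 →L[ℝ] E3 →L[ℝ] ℝ) (x u v w : E3) :
    riemann G x u v w = curvatureAt G x u v w := by
  have h : ∀ y a b : E3, christoffel G y a b = christoffelLeft G a y b := fun _ _ _ ↦ rfl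
  simp only [riemann, curvatureAt, h]

/-- Stated only at the centre of the preferred chart, the point where `curvatureForm` is evaluated.
For an orthonormal pair the denominator of the sectional curvature is one. -/
theorem curvatureAt_nonpos {g : Metric M} (hg : HasNonposCurvature g) (p : M) {u v : E3}
    (hu : metricInChart g p (extChartAt (𝓡 3) p p) u u = 1)
    (hv : metricInChart g p (extChartAt (𝓡 3) p p) v v = 1)
    (huv : metricInChart g p (extChartAt (𝓡 3) p p) u v = 0) :
    metricInChart g p (extChartAt (𝓡 3) p p)
      (curvatureAt (metricInChart g p) (extChartAt (𝓡 3) p p) u v v) u ≤ 0 := by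
  have hp := mem_extChartAt_source (I := 𝓡 3) p
  have hu' := chartDeriv_chartField hp fun _ ↦ u
  have hv' := chartDeriv_chartField hp fun _ ↦ v
  set a := chartField p (fun _ ↦ u) p
  set b := chartField p (fun _ ↦ v) p
  have hvu : metricInChart g p (extChartAt (𝓡 3) p p) v u = 0 := huv ▸ g.symm _ _ _
  have hli : LinearIndependent ℝ ![a, b] := by
    rw [LinearIndependent.pair_iff]
    intro s t hst
    have h0 := congrArg (chartDeriv p p) hst
    rw [map_add, map_smul, map_smul, hu', hv', map_zero] at h0
    have h1 := congrArg (metricInChart g p (extChartAt (𝓡 3) p p) u) h0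
    have h2 := congrArg (metricInChart g p (extChartAt (𝓡 3) p p) v) h0
    rw [map_add, map_smul, map_smul, hu, huv, map_zero] at h1
    rw [map_add, map_smul, map_smul, hv, hvu, map_zero] at h2
    simpa using And.intro h1 h2
  have h := hg p a b hli
  rw [sectionalCurvature, ← metricInChart_chartDeriv g hp, ← metricInChart_chartDeriv g hp,
    ← metricInChart_chartDeriv g hp, hu', hv', hu, hv, huv] at h
  have h2 : curvatureForm g p a b = metricInChart g p (extChartAt (𝓡 3) p p)
      (riemann (metricInChart g p) (extChartAt (𝓡 3) p p) (chartDeriv p p a) (chartDeriv p p b)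
        (chartDeriv p p b)) (chartDeriv p p a) := rfl
  rw [h2, hu', hv', riemann_eq_curvatureAt] at h
  simpa using h

theorem lieMetric_ne_zero {g : Metric M} (hg : HasNonposCurvature g)
    {N : ∀ p : M, TangentSpace (𝓡 3) p} {k : ℝ}
    (hloc : ∀ p, IsContactMetricOn (metricInChart g p) (fieldInChart N p) k
      (extChartAt (𝓡 3) p).target) {p q : M} (hq : q ∈ (extChartAt (𝓡 3) p).source) :
    lieMetric (metricInChart g p) (fieldInChart N p) (extChartAt (𝓡 3) p q) ≠ 0 := by
  intro h0
  have hV : Module.finrank ℝ E3 = 3 := by simp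
  have hqq := mem_extChartAt_source (I := 𝓡 3) q
  have hy := mem_extChartAt_target (I := 𝓡 3) q
  -- The vanishing is carried to the chart centred at `q`, where the curvature bound is available.
  have hQ : lieMetric (metricInChart g q) (fieldInChart N q) (extChartAt (𝓡 3) q q) = 0 := by
    ext u v
    have := lieMetric_transition hloc hq hqq (chartField q (fun _ ↦ u) q)
      (chartField q (fun _ ↦ v) q)
    rw [h0, chartDeriv_chartField hqq, chartDeriv_chartField hqq] at this
    simpa using this
  obtain ⟨e, f, hf⟩ := exists_isFrame hV ((hloc q).symm _ hy) ((hloc q).pos _ hy)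
    ((hloc q).unit _ hy)
  have h1 := (hloc q).ricci_reeb_pos hV hy hf hQ
  have h2 := curvatureAt_nonpos hg q hf.ee hf.nn hf.en
  have h3 := curvatureAt_nonpos hg q hf.ff hf.nn hf.fn
  linarith

end Curvature

/-! ### The eigenlines of `L_N g` as smooth line subbundles splitting the contact structure. -/

section Splitting

variable {M : Type*} [TopologicalSpace M] [ChartedSpace E3 M] [IsManifold (𝓡 3) ∞ M]

/-- The Lie derivative of the metric along `N` as an endomorphism, in the preferred chart at `p`. -/
def shapeInChart (g : Metric M) (N : ∀ p : M, TangentSpace (𝓡 3) p) (p : M) (y : E3) :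
    E3 →L[ℝ] E3 :=
  (metricInChart g p y).inverse.comp (lieMetric (metricInChart g p) (fieldInChart N p) y)

/-- The eigenspace for `s λ` of the Lie derivative of the metric along `N`, where `λ` is the positive
eigenvalue. -/
def eigenline (g : Metric M) (N : ∀ p : M, TangentSpace (𝓡 3) p) (s : ℝ) (q : M) :
    Submodule ℝ (TangentSpace (𝓡 3) q) :=
  LinearMap.ker (((shapeInChart g N q (extChartAt (𝓡 3) q q)
    - (s * shapeEigenvalue (shapeInChart g N q (extChartAt (𝓡 3) q q))) •
      ContinuousLinearMap.id ℝ E3).comp (chartDeriv q q) : TangentSpace (𝓡 3) q →L[ℝ] E3) :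
        TangentSpace (𝓡 3) q →ₗ[ℝ] E3)

theorem mem_eigenline_self {g : Metric M} {N : ∀ p : M, TangentSpace (𝓡 3) p} {s : ℝ} {q : M}
    {v : TangentSpace (𝓡 3) q} :
    v ∈ eigenline g N s q ↔ shapeInChart g N q (extChartAt (𝓡 3) q q) (chartDeriv q q v) =
      (s * shapeEigenvalue (shapeInChart g N q (extChartAt (𝓡 3) q q))) • chartDeriv q q v := by
  rw [eigenline, LinearMap.mem_ker, ← sub_eq_zero (a := shapeInChart g N q _ _)]
  rfl

variable {g : Metric M} {N : ∀ p : M, TangentSpace (𝓡 3) p} {k : ℝ} {s : ℝ}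

theorem metric_shapeInChart (hloc : ∀ p, IsContactMetricOn (metricInChart g p) (fieldInChart N p) k
    (extChartAt (𝓡 3) p).target) {p : M} {y : E3} (hy : y ∈ (extChartAt (𝓡 3) p).target)
    (u v : E3) : metricInChart g p y (shapeInChart g N p y u) v =
      lieMetric (metricInChart g p) (fieldInChart N p) y u v := by
  rw [shapeInChart, ContinuousLinearMap.comp_apply, apply_inverse_of_pos ((hloc p).pos y hy)]

theorem exists_shape_conj (hloc : ∀ p, IsContactMetricOn (metricInChart g p) (fieldInChart N p) k
    (extChartAt (𝓡 3) p).target) {p q : M} (hq : q ∈ (extChartAt (𝓡 3) p).source) :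
    ∃ A : E3 ≃L[ℝ] E3, (∀ v, chartDeriv p q v = A (chartDeriv q q v)) ∧
      ∀ w, shapeInChart g N p (extChartAt (𝓡 3) p q) (A w) =
        A (shapeInChart g N q (extChartAt (𝓡 3) q q) w) := by
  have hqq := mem_extChartAt_source (I := 𝓡 3) q
  obtain ⟨e, he⟩ := isInvertible_chartDeriv hqq
  obtain ⟨f, hf⟩ := isInvertible_chartDeriv hq
  refine ⟨e.symm.trans f, fun v ↦ by simp [← he, ← hf], fun w ↦ ?_⟩
  have hy := (extChartAt (𝓡 3) p).map_source hq
  have hA : ∀ z, (e.symm.trans f) z = chartDeriv p q (e.symm z) := fun z ↦ by simp [← hf]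
  have hB : ∀ z, chartDeriv q q (e.symm z) = z := fun z ↦ by simp [← he]
  refine eq_of_forall_apply_eq ((hloc p).pos _ hy) fun z ↦ ?_
  obtain ⟨z, rfl⟩ := f.surjective z
  have hz : f z = chartDeriv p q z := by rw [← hf]; rfl
  rw [metric_shapeInChart hloc hy, hz, hA, hA, metricInChart_chartDeriv g hq,
    ← lieMetric_transition hloc hq hqq, ← metricInChart_chartDeriv g hqq, hB, hB,
    metric_shapeInChart hloc ((extChartAt (𝓡 3) q).map_source hqq)]

/-- `eigenline` uses a different chart at each point; here the condition is moved to one fixed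
chart, as a smooth local section requires. The endomorphisms in the two charts are conjugate, so `λ`
agrees. -/
theorem mem_eigenline (hloc : ∀ p, IsContactMetricOn (metricInChart g p) (fieldInChart N p) k
    (extChartAt (𝓡 3) p).target) {p q : M} (hq : q ∈ (extChartAt (𝓡 3) p).source)
    {v : TangentSpace (𝓡 3) q} :
    v ∈ eigenline g N s q ↔ shapeInChart g N p (extChartAt (𝓡 3) p q) (chartDeriv p q v) =
      (s * shapeEigenvalue (shapeInChart g N p (extChartAt (𝓡 3) p q))) • chartDeriv p q v := by
  obtain ⟨A, hA1, hA2⟩ := exists_shape_conj hloc hq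
  have hlam : shapeEigenvalue (shapeInChart g N p (extChartAt (𝓡 3) p q)) =
      shapeEigenvalue (shapeInChart g N q (extChartAt (𝓡 3) q q)) := by
    rw [shapeEigenvalue, shapeEigenvalue]
    have : ((shapeInChart g N p (extChartAt (𝓡 3) p q)).comp
        (shapeInChart g N p (extChartAt (𝓡 3) p q)) : E3 →ₗ[ℝ] E3) =
        A.toLinearEquiv.conj ((shapeInChart g N q (extChartAt (𝓡 3) q q)).comp
          (shapeInChart g N q (extChartAt (𝓡 3) q q)) : E3 →L[ℝ] E3) := by
      ext1 w
      obtain ⟨w, rfl⟩ := A.surjective w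
      rw [LinearEquiv.conj_apply_apply]
      change shapeInChart g N p _ (shapeInChart g N p _ (A w)) =
        A (shapeInChart g N q _ (shapeInChart g N q _ (A.symm (A w))))
      rw [hA2, hA2, A.symm_apply_apply]
    rw [this, LinearMap.trace_conj']
  rw [mem_eigenline_self, hlam, hA1, hA2, ← A.map_smul, A.injective.eq_iff]

theorem isShape_shapeInChart (hg : HasNonposCurvature g)
    (hloc : ∀ p, IsContactMetricOn (metricInChart g p) (fieldInChart N p) k
      (extChartAt (𝓡 3) p).target) {p q : M} (hq : q ∈ (extChartAt (𝓡 3) p).source) :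
    IsShape (shapeInChart g N p (extChartAt (𝓡 3) p q))
      (metricInChart g p (extChartAt (𝓡 3) p q) (fieldInChart N p (extChartAt (𝓡 3) p q))) := by
  have hy := (extChartAt (𝓡 3) p).map_source hq
  exact isShape_inverse_comp (by simp) ((hloc p).symm _ hy) ((hloc p).pos _ hy)
    ((hloc p).unit _ hy) ((hloc p).lieMetric_symm hy) ((hloc p).lieMetric_reeb hy)
    (fun u v ↦ (hloc p).lieMetric_area hy) (lieMetric_ne_zero hg hloc hq)

theorem contDiffAt_shapeInChart
    (hloc : ∀ p, IsContactMetricOn (metricInChart g p) (fieldInChart N p) k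
      (extChartAt (𝓡 3) p).target) {p : M} {y : E3} (hy : y ∈ (extChartAt (𝓡 3) p).target) :
    ContDiffAt ℝ ∞ (shapeInChart g N p) y :=
  ((hloc p).contDiffAt_inverse_metric hy).clm_comp ((hloc p).contDiffAt_lieMetric hy)

/-- The square root is smooth because `tr(T²)` is positive; here the nonvanishing of `L_N g` enters.
-/
theorem contDiffAt_shapeEigenvalue {E : Type*} [NormedAddCommGroup E] [NormedSpace ℝ E]
    {T : E → E3 →L[ℝ] E3} {φ : E3 →L[ℝ] ℝ} {y : E} (hT : ContDiffAt ℝ ∞ T y)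
    (h : IsShape (T y) φ) : ContDiffAt ℝ ∞ (fun z ↦ shapeEigenvalue (T z)) y := by
  let tr : (E3 →L[ℝ] E3) →L[ℝ] ℝ :=
    ((LinearMap.trace ℝ E3).comp (ContinuousLinearMap.coeLM ℝ)).toContinuousLinearMap
  have h1 : ContDiffAt ℝ ∞ (fun z ↦ tr ((T z).comp (T z)) / 2) y :=
    (tr.contDiff.contDiffAt.comp y (hT.clm_comp hT)).div_const 2
  have h2 : tr ((T y).comp (T y)) / 2 ≠ 0 := (half_pos h.trace_pos).ne'
  exact h1.sqrt h2

theorem isLineSubbundle_eigenline (hg : HasNonposCurvature g)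
    (hloc : ∀ p, IsContactMetricOn (metricInChart g p) (fieldInChart N p) k
      (extChartAt (𝓡 3) p).target) (hs : s ^ 2 = 1) : IsLineSubbundle (eigenline g N s) := by
  intro p
  have hp := mem_extChartAt_source (I := 𝓡 3) p
  obtain ⟨v, hv⟩ := (isShape_shapeInChart hg hloc hp).exists_add_smul_ne_zero hs
  set T := shapeInChart g N p with hT
  -- `T² + s λ T` maps every vector into the eigenline for `s λ`, so a fixed `v` gives a smooth
  -- section there, nonzero near `p` by the choice of `v`.
  let F : E3 → E3 := fun y ↦ T y (T y v) + (s * shapeEigenvalue (T y)) • T y v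
  have hF : ∀ q ∈ (extChartAt (𝓡 3) p).source, ContDiffAt ℝ ∞ F (extChartAt (𝓡 3) p q) := by
    intro q hq
    have h1 := contDiffAt_shapeInChart hloc ((extChartAt (𝓡 3) p).map_source hq)
    have h2 := h1.clm_const_apply v
    exact (h1.clm_apply h2).add ((contDiffAt_const.mul
      (contDiffAt_shapeEigenvalue h1 (isShape_shapeInChart hg hloc hq))).smul h2)
  have hc : ContinuousOn (fun q ↦ F (extChartAt (𝓡 3) p q)) (extChartAt (𝓡 3) p).source :=
    fun q hq ↦ ((hF q hq).continuousAt.comp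
      (continuousAt_extChartAt' (I := 𝓡 3) hq)).continuousWithinAt
  refine ⟨(extChartAt (𝓡 3) p).source ∩ (fun q ↦ F (extChartAt (𝓡 3) p q)) ⁻¹' {0}ᶜ,
    hc.isOpen_inter_preimage (isOpen_extChartAt_source p) isOpen_compl_singleton, ⟨hp, hv⟩,
    chartField p F, smoothVectorFieldOn_chartField inter_subset_left fun q hq ↦ hF q hq.1, ?_⟩
  rintro q ⟨hq, hFq⟩
  have hX := chartDeriv_chartField hq F
  have hsh := isShape_shapeInChart hg hloc hq
  have hFq' : F (extChartAt (𝓡 3) p q) ≠ 0 := hFq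
  have hmem : chartField p F q ∈ eigenline g N s q := by
    rw [mem_eigenline hloc hq, hX]
    exact hsh.apply_add_smul hs v
  refine ⟨fun h0 ↦ ?_, le_antisymm (fun w hw ↦ ?_) ?_⟩
  · rw [h0, map_zero] at hX
    exact hFq' hX.symm
  · rw [mem_eigenline hloc hq] at hw hmem
    obtain ⟨r, hr⟩ := hsh.exists_eq_smul hs (by rwa [hX]) hmem hw
    rw [← map_smul] at hr
    exact Submodule.mem_span_singleton.2 ⟨r, (chartDeriv_injective hq hr).symm⟩
  · rwa [Submodule.span_singleton_le_iff_mem]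

theorem splitsIntoLines_of_nonpos {ξ : ∀ p : M, Submodule ℝ (TangentSpace (𝓡 3) p)}
    (hg : HasNonposCurvature g)
    (hloc : ∀ p, IsContactMetricOn (metricInChart g p) (fieldInChart N p) k
      (extChartAt (𝓡 3) p).target)
    (hξ : ∀ (p : M) (v : TangentSpace (𝓡 3) p), v ∈ ξ p ↔ g.inner p (N p) v = 0) :
    SplitsIntoLines ξ := by
  refine ⟨eigenline g N 1, eigenline g N (-1), isLineSubbundle_eigenline hg hloc (by norm_num),
    isLineSubbundle_eigenline hg hloc (by norm_num), fun q ↦ ?_⟩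
  have hq := mem_extChartAt_source (I := 𝓡 3) q
  have hsh := isShape_shapeInChart hg hloc hq
  have hl := hsh.shapeEigenvalue_pos.ne'
  have hker : ∀ v : TangentSpace (𝓡 3) q, v ∈ ξ q ↔ metricInChart g q (extChartAt (𝓡 3) q q)
      (fieldInChart N q (extChartAt (𝓡 3) q q)) (chartDeriv q q v) = 0 := by
    intro v
    rw [fieldInChart_chart N hq, metricInChart_chartDeriv g hq, hξ]
  refine ⟨?_, le_antisymm (sup_le ?_ ?_) fun v hv ↦ ?_⟩
  · rw [Submodule.disjoint_def]
    intro v h1 h2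
    rw [mem_eigenline_self] at h1 h2
    rw [h1] at h2
    refine chartDeriv_injective hq ?_
    rw [map_zero]
    have h3 : (2 * shapeEigenvalue (shapeInChart g N q (extChartAt (𝓡 3) q q))) •
        chartDeriv q q v = 0 := by
      rw [← sub_eq_zero] at h2
      rw [← h2]
      module
    exact (smul_eq_zero.1 h3).resolve_left (mul_ne_zero two_ne_zero hl)
  · intro v hv
    rw [mem_eigenline_self] at hv
    exact (hker v).2 (hsh.apply_eq_zero_of_eigen (by norm_num) hv)
  · intro v hv
    rw [mem_eigenline_self] at hv
    exact (hker v).2 (hsh.apply_eq_zero_of_eigen (by norm_num) hv)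
  · have h2 := hsh.apply_apply ((hker v).1 hv)
    set T := shapeInChart g N q (extChartAt (𝓡 3) q q) with hT
    set l := shapeEigenvalue T with hldef
    obtain ⟨e, he⟩ := isInvertible_chartDeriv hq
    have hB : ∀ z, chartDeriv q q (e.symm z) = z := fun z ↦ by simp [← he]
    set t := e.symm (T (chartDeriv q q v))
    have ht : chartDeriv q q t = T (chartDeriv q q v) := hB _
    rw [Submodule.mem_sup]
    -- The spectral projections `(1 ± λ⁻¹ T) / 2` applied to `v`, where `t` is the tangent vector
    -- representing `T v`; they work because `T² = λ²` on `ξ`.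
    refine ⟨(1 / 2 : ℝ) • (v + l⁻¹ • t), ?_, (1 / 2 : ℝ) • (v - l⁻¹ • t), ?_, by module⟩
    · rw [mem_eigenline_self, ← hT, ← hldef]
      simp only [map_smul, map_add, ht, h2, smul_smul, smul_add]
      rw [add_comm]
      congr 2 <;> field_simp
    · rw [mem_eigenline_self, ← hT, ← hldef]
      simp only [map_smul, map_sub, ht, h2, smul_smul, smul_sub]
      match_scalars <;> field_simp

end Splitting

end ContactGeometry

end

theorem mainTheorem1 {M : Type*} [TopologicalSpace M] [T2Space M] [CompactSpace M]
    [ChartedSpace E3 M] [IsManifold (𝓡 3) ∞ M]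
    (ξ : ∀ p : M, Submodule ℝ (TangentSpace (𝓡 3) p))
    (hξ : IsContactStructure ξ) (hsplit : ¬ SplitsIntoLines ξ)
    (g : Metric M) (hg : IsCompatible g ξ) :
    ¬ HasNonposCurvature g := by 
  intro hcurv
  obtain ⟨α, N, J, k, hα, hN, hJ, hNg, hk⟩ := hg
  have hloc := isContactMetricOn_chart hα hN (fun p ↦ (hJ p).2) hNg hk
  refine hsplit (splitsIntoLines_of_nonpos hcurv hloc fun p v ↦ ?_)
  rw [hNg, (hα.2 p (mem_univ p)).2]
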